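/- Let $k$ be a field. A commutative graded $k$-algebra $A=\bigoplus_{n\ge 0}A_n$ is called standard graded if $A_0=k$ and $A$ is generated as a $k$-algebra by finitely many elements of $A_1$. For $r\ge 1$ its $r$-th Veronese algebra is $A^{\langle r\rangle}=\bigoplus_{n\ge 0}A_{nr}$, with degree $n$ component $A_{nr}$ and Hilbert series $\mathrm{Hilb}(A^{\langle r\rangle},t)=\sum_{n\ge 0}\dim_k(A_{nr})\,t^n$. For every $d\ge 2$ there are strictly negative real numbers $\alpha_1,\dots,\alpha_{d-2}$, depending only on $d$, such that for every field $k$ and every standard graded $k$-algebra $A$ of Krull dimension $d$ there are an integer $R>0$ and sequences of complex numbers $(\beta_r^{(i)})_{r\ge 1}$, $1\le i\le d$, such that: (i) for all $r>R$, $\beta_r^{(i)}$ is real for $1\le i\le d$ and strictly negative for $1\le i\le d-1$; (ii) $\beta_r^{(i)}\to\alpha_i$ as $r\to\infty$ for $1\le i\le d-2$; (iii) $\beta_r^{(d-1)}\to-\infty$ as $r\to\infty$; (iv) $\beta_r^{(d)}\to 0$ as $r\to\infty$; (v) for all $r>R$, $$\mathrm{Hilb}(A^{\langle r\rangle},t)=\frac{h^{\langle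 r\rangle}(t)}{(1-t)^d}$$ with a polynomial $h^{\langle r\rangle}(t)\in\mathbb Z[t]$ that satisfies $$h^{\langle r\rangle}(t)=\prod_{i=1}^{d}\bigl(1-\beta_r^{(i)}t\bigr).$$ -/

import Mathlib

namespace GradedHilbert

/-- The algebra `A` over `k`, graded by `𝒜`, is standard graded: `A_0 = k`, and `A` is generated as
a `k`-algebra by finitely many elements of degree one. -/
structure IsStandardGraded {k A : Type*} [Field k] [CommRing A] [Algebra k A]
    (𝒜 : ℕ → Submodule k A) [GradedAlgebra 𝒜] : Prop where
  degree_zero : Function.Bijective (algebraMap k (𝒜 0))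
  fg_degree_one : ∃ s : Finset A, (∀ a ∈ s, a ∈ 𝒜 1) ∧ Algebra.adjoin k (s : Set A) = ⊤

/-- The Hilbert series `∑ (dim_k M_n) t^n` of a family `M_n` of (finite-dimensional) subspaces. -/
noncomputable def hilbertSeries {k M : Type*} [Field k] [AddCommGroup M] [Module k M]
    (ℳ : ℕ → Submodule k M) : PowerSeries ℤ :=
  PowerSeries.mk fun n => (Module.finrank k (ℳ n) : ℤ)

section

variable {k A : Type*} [Field k] [CommRing A] [Algebra k A]

theorem one_mem_iSup_graded (𝒜 : ℕ → Submodule k A) [SetLike.GradedMonoid 𝒜] (r : ℕ) :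
    (1 : A) ∈ ⨆ n, 𝒜 (n * r) := by
  refine Submodule.mem_iSup_of_mem 0 ?_
  rw [Nat.zero_mul]
  exact SetLike.GradedOne.one_mem

theorem mul_mem_iSup_graded (𝒜 : ℕ → Submodule k A) [SetLike.GradedMonoid 𝒜] (r : ℕ) (x y : A)
    (hx : x ∈ ⨆ n, 𝒜 (n * r)) (hy : y ∈ ⨆ n, 𝒜 (n * r)) : x * y ∈ ⨆ n, 𝒜 (n * r) := by
  induction hx using Submodule.iSup_induction' with
  | zero => simp
  | add a b _ _ ha hb => rw [add_mul]; exact add_mem ha hb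
  | mem i a ha =>
    induction hy using Submodule.iSup_induction' with
    | zero => simp
    | add b c _ _ hb hc => rw [mul_add]; exact add_mem hb hc
    | mem j b hb =>
      refine Submodule.mem_iSup_of_mem (i + j) ?_
      rw [Nat.add_mul]
      exact SetLike.GradedMul.mul_mem ha hb

/-- The `r`-th Veronese algebra `⨁ A_{nr}` of a graded algebra `A = ⨁ A_n`. -/
def veronese (𝒜 : ℕ → Submodule k A) [SetLike.GradedMonoid 𝒜] (r : ℕ) : Subalgebra k A :=
  (⨆ n, 𝒜 (n * r)).toSubalgebra (one_mem_iSup_graded 𝒜 r) (mul_mem_iSup_graded 𝒜 r)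

/-- The grading of the `r`-th Veronese algebra: its degree `n` component is `A_{nr}`. -/
def veroneseGrading (𝒜 : ℕ → Submodule k A) [SetLike.GradedMonoid 𝒜] (r : ℕ) :
    ℕ → Submodule k (veronese 𝒜 r) :=
  fun n => (𝒜 (n * r)).comap (veronese 𝒜 r).val.toLinearMap

/-- `h` is the numerator of the Hilbert series of `ℳ` over `(1 - t)^d`, that is, the Hilbert series
equals `h(t) / (1 - t)^d`. Since `(1 - t)^d` is invertible as a power series, there is at most one
such `h`. -/
def IsHPolynomial {M : Type*} [AddCommGroup M] [Module k M] (ℳ : ℕ → Submodule k M) (d : ℕ)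
    (h : Polynomial ℤ) : Prop :=
  hilbertSeries ℳ * (1 - PowerSeries.X) ^ d = (h : PowerSeries ℤ)

end

end GradedHilbert

/-! ### Power sum series and the roots of their numerators. -/

section Numerators

open Polynomial Filter Topology

/-! Put `u = 1/(1-t)`. Then `∑ n^j t^n = G_j(u)`, where `G_j = powerSumPoly j` has degree `j+1`. By
Rolle, `G_{d-1}` has the simple roots `0`, `1` and `d-2` further ones in `(0,1)`. The Hilbert
function `H` of `A` agrees for large `n` with a polynomial `p` of degree `d-1`. Hence for large `r`
the Veronese series is `F_r(u)`, with `F_r = veronesePoly p d r` of degree at most `d`, and `F_r /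
r^(d-1)` converges pointwise to a nonzero multiple of `G_{d-1}`.

A root `b ≠ 1` of `F_r` yields the numerator factor `1 - βt` with `β = b/(b-1)`, because `(1-t)(u-b)
= (1-b)(1-βt)`. Simple roots persist under the limit, so the roots in `(0,1)` give the negative
limits `α_i`, which depend on `d` only, and the root `0` gives `β → 0`. The root `1` corresponds to
`β = ∞` and is not followed: one linear factor remains, and the coefficient of `t` forces its
parameter to be `d - H(r)` minus the other `β`s, which tends to `-∞`.

That `p` exists is the Hilbert–Serre theorem (`exists_hilbertSeries_mul_eq`). Its degree comes from
Noether normalization: `A` is finite over a polynomial ring in `d` variables, so `∑_{i ≤ n} dim A_i`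
grows like `n^d` (`exists_growth_lower_bound`, `exists_growth_upper_bound`,
`natDegree_eq_of_growth`). -/

/-- The polynomials `G j` with `∑ n ^ j t ^ n = G j (1 / (1 - t))`. -/
noncomputable def powerSumPoly : ℕ → ℝ[X]
  | 0 => X
  | j + 1 => X * (X - 1) * derivative (powerSumPoly j)

theorem natDegree_powerSumPoly (j : ℕ) : (powerSumPoly j).natDegree = j + 1 := by
  induction j with
  | zero => simp [powerSumPoly]
  | succ j ih =>
    have h1 : (X - 1 : ℝ[X]).natDegree = 1 := by
      simpa using natDegree_X_sub_C (1 : ℝ)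
    have h1' : (X - 1 : ℝ[X]) ≠ 0 := fun h => by simp [h] at h1
    have hd : (derivative (powerSumPoly j)).natDegree = j := by
      rw [natDegree_derivative, ih]; rfl
    have hd' : derivative (powerSumPoly j) ≠ 0 := by
      intro h
      have := derivative_eq_zero.1 h
      omega
    rw [powerSumPoly, natDegree_mul (mul_ne_zero X_ne_zero h1') hd',
      natDegree_mul X_ne_zero h1', natDegree_X, h1, hd]
    omega

theorem powerSumPoly_ne_zero (j : ℕ) : powerSumPoly j ≠ 0 := fun h => by
  have := natDegree_powerSumPoly j
  simp [h] at this

/-- The operator `t d/dt` multiplies the `n`-th coefficient by `n`, and on polynomials in `u` it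
acts as `u(u-1) d/du`, since `u' = u²` and `tu = u - 1`. The case `j = 0` uses `0^0 = 1`. -/
theorem aeval_powerSumPoly (j : ℕ) :
    aeval (PowerSeries.mk 1 : PowerSeries ℝ) (powerSumPoly j) =
      PowerSeries.mk fun n => (n : ℝ) ^ j := by
  induction j with
  | zero => ext n; simp [powerSumPoly]
  | succ j ih =>
    set U : PowerSeries ℝ := PowerSeries.mk 1 with hU
    have hUX : U * (1 - PowerSeries.X) = 1 := PowerSeries.mk_one_mul_one_sub_eq_one ℝ
    have hdU : PowerSeries.derivative ℝ U = U ^ 2 := by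
      have h := congrArg (PowerSeries.derivative ℝ) hUX
      rw [Derivation.leibniz, map_sub, PowerSeries.derivative_X, PowerSeries.derivative_one] at h
      simp only [smul_eq_mul] at h
      have h2 : U * (U * (0 - 1) + (1 - PowerSeries.X) * PowerSeries.derivative ℝ U) = 0 := by
        rw [h, mul_zero]
      linear_combination h2 - (PowerSeries.derivative ℝ U) * hUX
    have h := Derivation.map_aeval (PowerSeries.derivative ℝ) (powerSumPoly j) U
    rw [ih, hdU, smul_eq_mul] at h
    have h3 : aeval U (powerSumPoly (j + 1)) =
        PowerSeries.X * (PowerSeries.derivative ℝ (PowerSeries.mk fun n : ℕ => (n : ℝ) ^ j)) := by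
      rw [h, powerSumPoly]
      simp only [map_mul, map_sub, aeval_X, map_one]
      linear_combination (U * aeval U (derivative (powerSumPoly j))) * hUX
    rw [h3]
    ext n
    cases n with
    | zero => simp
    | succ n =>
      rw [PowerSeries.coeff_succ_X_mul, PowerSeries.coeff_derivative]
      simp only [PowerSeries.coeff_mk]
      push_cast
      ring

theorem exists_roots_derivative {p : ℝ[X]} {n : ℕ} {a b : ℝ} (S : Finset ℝ) (hS : S.card = n + 1)
    (hab : ∀ x ∈ S, x ∈ Set.Icc a b) (hp : ∀ x ∈ S, p.eval x = 0) :
    ∃ T : Finset ℝ, T.card = n ∧ (∀ x ∈ T, x ∈ Set.Ioo a b) ∧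
      ∀ x ∈ T, (derivative p).eval x = 0 := by
  set e := S.orderEmbOfFin hS
  have he : ∀ i, e i ∈ S := fun i => S.orderEmbOfFin_mem hS i
  have key : ∀ i : Fin n, ∃ c ∈ Set.Ioo (e i.castSucc) (e i.succ), (derivative p).eval c = 0 := by
    intro i
    obtain ⟨c, hc, h⟩ := exists_deriv_eq_zero (f := fun x => p.eval x)
      (e.strictMono (Fin.castSucc_lt_succ (i := i))) p.continuous.continuousOn
      (by rw [hp _ (he _), hp _ (he _)])
    exact ⟨c, hc, by rwa [Polynomial.deriv] at h⟩
  choose c hc hc0 using key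
  have hmono : StrictMono c := by
    intro i j hij
    calc c i < e i.succ := (hc i).2
      _ ≤ e j.castSucc := e.monotone (by
          rw [Fin.le_def]; simp only [Fin.val_succ, Fin.val_castSucc]; exact hij)
      _ < c j := (hc j).1
  refine ⟨Finset.univ.map ⟨c, hmono.injective⟩, by simp, ?_, ?_⟩
  · intro x hx
    obtain ⟨i, -, rfl⟩ := Finset.mem_map.1 hx
    exact ⟨(hab _ (he _)).1.trans_lt (hc i).1, (hc i).2.trans_le (hab _ (he _)).2⟩
  · intro x hx
    obtain ⟨i, -, rfl⟩ := Finset.mem_map.1 hx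
    exact hc0 i

/-- Rolle between consecutive roots of `G_{j+1}` in `[0,1]` produces `j+1` roots of its derivative
in `(0,1)`; the factor `X(X-1)` of the recursion restores the endpoints. -/
theorem exists_roots_powerSumPoly (j : ℕ) : ∃ S : Finset ℝ, S.card = j ∧
    (∀ x ∈ S, x ∈ Set.Ioo (0 : ℝ) 1) ∧
    ∀ x ∈ insert 0 (insert 1 S), (powerSumPoly (j + 1)).eval x = 0 := by
  have aux : ∀ (j : ℕ) (S : Finset ℝ), (∀ x ∈ S, x ∈ Set.Ioo (0 : ℝ) 1) →
      (∀ x ∈ S, (derivative (powerSumPoly j)).eval x = 0) →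
      ∀ x ∈ insert 0 (insert 1 S), (powerSumPoly (j + 1)).eval x = 0 := by
    intro j S _ h x hx
    rw [Finset.mem_insert, Finset.mem_insert] at hx
    rcases hx with rfl | rfl | hx
    · simp [powerSumPoly]
    · simp [powerSumPoly]
    · simp [powerSumPoly, h x hx]
  induction j with
  | zero => exact ⟨∅, rfl, by simp, aux 0 ∅ (by simp) (by simp)⟩
  | succ j ih =>
    obtain ⟨S, hc, hS, h0⟩ := ih
    have h1 : (1 : ℝ) ∉ S := fun h => lt_irrefl _ (hS _ h).2
    have h2 : (0 : ℝ) ∉ insert 1 S := by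
      rw [Finset.mem_insert]
      rintro (h | h)
      · norm_num at h
      · exact lt_irrefl _ (hS _ h).1
    obtain ⟨T, hT, hT1, hT0⟩ := exists_roots_derivative (n := j + 1) (a := 0) (b := 1)
      (insert 0 (insert 1 S)) (by
        rw [Finset.card_insert_of_notMem h2, Finset.card_insert_of_notMem h1, hc]) (by
        intro x hx
        rw [Finset.mem_insert, Finset.mem_insert] at hx
        rcases hx with rfl | rfl | hx
        · simp
        · simp
        · exact Set.Ioo_subset_Icc_self (hS x hx)) h0
    exact ⟨T, hT, hT1, aux _ T hT1 hT0⟩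

/-- As many distinct roots as the degree leaves no room for multiplicity. -/
theorem derivative_eval_ne_zero_of_card_roots {p : ℝ[X]} (hp : p ≠ 0) (S : Finset ℝ)
    (hS : ∀ x ∈ S, p.eval x = 0) (hc : p.natDegree ≤ S.card) {x : ℝ} (hx : x ∈ S) :
    (derivative p).eval x ≠ 0 := by
  intro h
  have hle : S.val ≤ p.roots := Multiset.le_iff_subset S.nodup |>.2 fun y hy =>
    (mem_roots hp).2 (hS y hy)
  have heq : S.val = p.roots :=
    Multiset.eq_of_le_of_card_le hle ((card_roots' p).trans hc)
  have h1 := (one_lt_rootMultiplicity_iff_isRoot hp (t := x)).2 ⟨hS x hx, h⟩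
  rw [← count_roots, ← heq] at h1
  exact absurd (Multiset.nodup_iff_count_le_one.1 S.nodup x) (by omega)

/-- A pointwise limit of continuous functions has near a simple root a root of the approximants. -/
theorem exists_tendsto_root {f : ℕ → ℝ → ℝ} {g : ℝ → ℝ} {z : ℝ} (hf : ∀ r, Continuous (f r))
    (hfg : ∀ x, Tendsto (fun r => f r x) atTop (𝓝 (g x))) (hz : g z = 0) (hd : deriv g z ≠ 0) :
    ∃ b : ℕ → ℝ, Tendsto b atTop (𝓝 z) ∧ ∀ᶠ r in atTop, f r (b r) = 0 := by
  -- At a simple zero `g` changes sign, so for large `r` the function `f r` has opposite signs at `z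
  -- - η` and `z + η`, and the intermediate value theorem applies.
  have key : ∀ ε > 0, ∀ᶠ r in atTop, ∃ x, |x - z| < ε ∧ f r x = 0 := by
    intro ε hε
    have hsign : ∀ᶠ x in 𝓝 z, x ≠ z → 0 < g x * ((x - z) * deriv g z) := by
      rcases lt_or_gt_of_ne hd with h | h
      · filter_upwards [eventually_nhdsWithin_sign_eq_of_deriv_neg h hz] with x hx hne
        rcases lt_or_gt_of_ne hne with h' | h'
        · have h1 : 0 < z - x := by linarith
          rw [sign_pos h1, sign_eq_one_iff] at hx
          have : 0 < (x - z) * deriv g z := mul_pos_of_neg_of_neg (by linarith) h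
          positivity
        · have h1 : z - x < 0 := by linarith
          rw [sign_neg h1, sign_eq_neg_one_iff] at hx
          exact mul_pos_of_neg_of_neg hx (mul_neg_of_pos_of_neg (by linarith) h)
      · filter_upwards [eventually_nhdsWithin_sign_eq_of_deriv_pos h hz] with x hx hne
        rcases lt_or_gt_of_ne hne with h' | h'
        · have h1 : x - z < 0 := by linarith
          rw [sign_neg h1, sign_eq_neg_one_iff] at hx
          exact mul_pos_of_neg_of_neg hx (mul_neg_of_neg_of_pos h1 h)
        · have h1 : 0 < x - z := by linarith
          rw [sign_pos h1, sign_eq_one_iff] at hx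
          positivity
    obtain ⟨δ, hδ, hball⟩ := Metric.eventually_nhds_iff.1 hsign
    set η := min δ ε / 2 with hη
    have hη0 : 0 < η := by have := lt_min hδ hε; positivity
    have hηδ : η < δ := by have := min_le_left δ ε; linarith
    have hηε : η < ε := by have := min_le_right δ ε; linarith
    have h1 := hball (y := z - η) (by rw [Real.dist_eq]; simpa [abs_of_pos hη0] using hηδ)
      (by linarith)
    have h2 := hball (y := z + η) (by rw [Real.dist_eq]; simpa [abs_of_pos hη0] using hηδ)
      (by linarith)
    have hneg : g (z - η) * g (z + η) < 0 := by
      have h3 := mul_pos h1 h2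
      by_contra hcon
      push Not at hcon
      have : 0 ≤ g (z - η) * g (z + η) * (η * deriv g z) ^ 2 := by positivity
      nlinarith
    filter_upwards [((hfg (z - η)).mul (hfg (z + η))).eventually_lt_const hneg] with r hr
    have hmem : (0 : ℝ) ∈ Set.uIcc (f r (z - η)) (f r (z + η)) := by
      rw [Set.mem_uIcc]
      rcases mul_neg_iff.1 hr with h | h
      · exact Or.inr ⟨h.2.le, h.1.le⟩
      · exact Or.inl ⟨h.1.le, h.2.le⟩
    obtain ⟨x, hx, hx0⟩ := intermediate_value_uIcc ((hf r).continuousOn) hmem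
    refine ⟨x, ?_, hx0⟩
    rw [Set.uIcc_of_le (by linarith)] at hx
    rw [abs_lt]
    constructor <;> linarith [hx.1, hx.2]
  -- A root nearest to `z` is chosen, which exists because the zero set is closed. This makes the
  -- sequence independent of `ε`.
  have hex : ∀ r, ∃ b, (∃ x, f r x = 0) → f r b = 0 ∧ ∀ x, f r x = 0 → |b - z| ≤ |x - z| := by
    intro r
    by_cases h : ∃ x, f r x = 0
    · have hcl : IsClosed {x | f r x = 0} := isClosed_eq (hf r) continuous_const
      obtain ⟨b, hb, hb'⟩ := hcl.exists_infDist_eq_dist h z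
      refine ⟨b, fun _ => ⟨hb, fun x hx => ?_⟩⟩
      have := Metric.infDist_le_dist_of_mem (x := z) (s := {x | f r x = 0}) hx
      rw [hb', dist_comm, dist_comm z x] at this
      simpa [Real.dist_eq] using this
    · exact ⟨0, fun h' => absurd h' h⟩
  choose b hb using hex
  refine ⟨b, Metric.tendsto_atTop'.2 fun ε hε => ?_, ?_⟩
  · obtain ⟨N, hN⟩ := eventually_atTop.1 (key ε hε)
    refine ⟨N, fun r hr => ?_⟩
    obtain ⟨x, hx, hx0⟩ := hN r hr.le
    rw [Real.dist_eq]
    exact ((hb r ⟨x, hx0⟩).2 x hx0).trans_lt hx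
  · filter_upwards [key 1 one_pos] with r ⟨x, _, hx0⟩
    exact (hb r ⟨x, hx0⟩).1

theorem exists_powerSumPoly_simple_roots {d : ℕ} (hd : 2 ≤ d) :
    ∃ v : ℕ → ℝ, Set.InjOn v ((Finset.Icc 1 d).erase (d - 1)) ∧
      (∀ i ∈ Finset.Icc 1 (d - 2), v i ∈ Set.Ioo (0 : ℝ) 1) ∧ v d = 0 ∧
      ∀ i ∈ (Finset.Icc 1 d).erase (d - 1), (powerSumPoly (d - 1)).eval (v i) = 0 ∧
        (derivative (powerSumPoly (d - 1))).eval (v i) ≠ 0 := by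
  obtain ⟨S, hS, hS1, hS0⟩ := exists_roots_powerSumPoly (d - 2)
  rw [show d - 2 + 1 = d - 1 by omega] at hS0
  have h1 : (1 : ℝ) ∉ S := fun h => lt_irrefl _ (hS1 _ h).2
  have h2 : (0 : ℝ) ∉ insert 1 S := by
    rw [Finset.mem_insert]
    rintro (h | h)
    · norm_num at h
    · exact lt_irrefl _ (hS1 _ h).1
  have hcard : (insert 0 (insert 1 S)).card = d := by
    rw [Finset.card_insert_of_notMem h2, Finset.card_insert_of_notMem h1, hS]
    omega
  set e := S.orderEmbOfFin hS
  have he : ∀ i, e i ∈ S := fun i => S.orderEmbOfFin_mem hS i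
  -- Indices `1, …, d-2` list the roots in `(0,1)`, and index `d` gets the root `0`. The value at
  -- `d-1` is junk: that index belongs to the root `1`, which is left out.
  let v : ℕ → ℝ := fun i => if h : i - 1 < d - 2 then e ⟨i - 1, h⟩ else 0
  have hmemI : ∀ i, i ∈ (Finset.Icc 1 d).erase (d - 1) → (1 ≤ i ∧ i - 1 < d - 2) ∨ i = d := by
    intro i hi
    simp only [Finset.mem_erase, Finset.mem_Icc] at hi
    omega
  have hvlt : ∀ i (h : i - 1 < d - 2), v i = e ⟨i - 1, h⟩ := fun i h => dif_pos h
  have hvd : v d = 0 := dif_neg (by omega)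
  refine ⟨v, ?_, ?_, hvd, ?_⟩
  · intro i hi j hj hij
    rcases hmemI i hi with ⟨h, h'⟩ | rfl <;> rcases hmemI j hj with ⟨g, g'⟩ | rfl
    · rw [hvlt i h', hvlt j g'] at hij
      have := e.injective hij
      rw [Fin.mk.injEq] at this
      omega
    · rw [hvlt i h', hvd] at hij
      exact absurd (hS1 _ (he _)).1 (by rw [hij]; simp)
    · rw [hvlt j g', hvd] at hij
      exact absurd (hS1 _ (he _)).1 (by rw [← hij]; simp)
    · rfl
  · intro i hi
    rw [Finset.mem_Icc] at hi
    rw [hvlt i (by omega)]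
    exact hS1 _ (he _)
  · intro i hi
    have hmem : v i ∈ insert 0 (insert 1 S) := by
      rcases hmemI i hi with ⟨h, h'⟩ | rfl
      · rw [hvlt i h']
        exact Finset.mem_insert_of_mem (Finset.mem_insert_of_mem (he _))
      · rw [hvd]
        exact Finset.mem_insert_self _ _
    refine ⟨hS0 _ hmem, derivative_eval_ne_zero_of_card_roots (powerSumPoly_ne_zero _) _ hS0 ?_ hmem⟩
    rw [natDegree_powerSumPoly, hcard]
    omega

/-! ### Factorization of the Veronese numerators. -/

theorem coeff_one_prod_one_sub {ι R : Type*} [CommRing R] (I : Finset ι) (b : ι → R) :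
    (∏ i ∈ I, (1 - C (b i) * X)).coeff 0 = 1 ∧
      (∏ i ∈ I, (1 - C (b i) * X)).coeff 1 = - ∑ i ∈ I, b i := by
  classical
  induction I using Finset.induction_on with
  | empty => simp [coeff_one]
  | insert a I ha ih =>
    rw [Finset.prod_insert ha, Finset.sum_insert ha]
    constructor
    · rw [mul_coeff_zero, ih.1]; simp
    · rw [mul_coeff_one, ih.1, ih.2]; simp [coeff_one]

/-- The numerator of `F (1 / (1 - t))` splits off a linear factor for each root of `F`. -/
theorem aeval_mul_one_sub_pow_eq_prod {ι : Type*} {F : ℝ[X]} {I : Finset ι} {b : ι → ℝ}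
    (hF : F.natDegree ≤ I.card + 1) (hb : Set.InjOn b I) (h0 : ∀ i ∈ I, F.eval (b i) = 0)
    (h1 : F.eval 1 = 1) :
    ∃ c : ℝ, aeval (PowerSeries.mk 1 : PowerSeries ℝ) F * (1 - PowerSeries.X) ^ (I.card + 1) =
      (((∏ i ∈ I, (1 - C (b i / (b i - 1)) * X)) * (1 - C c * X) : ℝ[X]) : PowerSeries ℝ) := by
  set U : PowerSeries ℝ := PowerSeries.mk 1 with hU
  have hUX : U * (1 - PowerSeries.X) = 1 := PowerSeries.mk_one_mul_one_sub_eq_one ℝ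
  have hdvd : (∏ i ∈ I, (X - C (b i))) ∣ F :=
    Finset.prod_dvd_of_coprime
      (fun i hi j hj hij => pairwise_coprime_X_sub_C (s := fun x : ℝ => x)
        Function.injective_id (fun h => hij (hb hi hj h)))
      fun i hi => dvd_iff_isRoot.2 (h0 i hi)
  obtain ⟨Q, hQ⟩ := hdvd
  have hF0 : F ≠ 0 := by rintro rfl; simp at h1
  have hmonic : (∏ i ∈ I, (X - C (b i))).Monic := monic_prod_of_monic _ _ fun i _ => monic_X_sub_C _
  -- The known roots account for all but at most one degree. The cofactor `pX + q` contributes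
  -- `(1-t)(pu + q) = (p+q) - qt`, hence `c = q/(p+q)`; the scalars pulled out of all factors
  -- multiply to `F(1) = 1`.
  have hQdeg : Q.natDegree ≤ 1 := by
    have hQ0 : Q ≠ 0 := by rintro rfl; simp [hF0] at hQ
    rw [hQ, hmonic.natDegree_mul' hQ0, natDegree_prod_of_monic _ _ fun i _ => monic_X_sub_C _] at hF
    simp only [natDegree_X_sub_C, Finset.sum_const, smul_eq_mul, mul_one] at hF
    omega
  obtain ⟨p, q, rfl⟩ := exists_eq_X_add_C_of_natDegree_le_one hQdeg
  have h1' : (∏ i ∈ I, (1 - b i)) * (p + q) = 1 := by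
    have h2 : ((∏ i ∈ I, (X - C (b i))) * (C p * X + C q)).eval 1 = 1 := by rw [← hQ, h1]
    simpa [eval_prod] using h2
  have hpq : p + q ≠ 0 := right_ne_zero_of_mul_eq_one h1'
  have hbi : ∀ i ∈ I, 1 - b i ≠ 0 := Finset.prod_ne_zero_iff.1 (left_ne_zero_of_mul_eq_one h1')
  refine ⟨q / (p + q), ?_⟩
  have e1 : ∀ i ∈ I, (1 - PowerSeries.X) * (U - PowerSeries.C (b i)) =
      PowerSeries.C (1 - b i) * (1 - PowerSeries.C (b i / (b i - 1)) * PowerSeries.X) := by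
    intro i hi
    have h2 : PowerSeries.C (1 - b i) * PowerSeries.C (b i / (b i - 1)) = -PowerSeries.C (b i) := by
      rw [← map_mul, ← map_neg]
      congr 1
      have := hbi i hi
      have h3 : b i - 1 ≠ 0 := fun h => this (by linarith)
      field_simp
      ring
    have h4 : PowerSeries.C (1 - b i) = 1 - PowerSeries.C (b i) := by rw [map_sub, map_one]
    linear_combination hUX + PowerSeries.X * h2 - h4
  have e2 : (1 - PowerSeries.X) * (PowerSeries.C p * U + PowerSeries.C q) =
      PowerSeries.C (p + q) * (1 - PowerSeries.C (q / (p + q)) * PowerSeries.X) := by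
    have h2 : PowerSeries.C (p + q) * PowerSeries.C (q / (p + q)) = PowerSeries.C q := by
      rw [← map_mul]
      congr 1
      field_simp
    have h4 : PowerSeries.C (p + q) = PowerSeries.C p + PowerSeries.C q := map_add _ _ _
    linear_combination PowerSeries.C p * hUX + PowerSeries.X * h2 - h4
  have e3 : aeval U F * (1 - PowerSeries.X) ^ (I.card + 1) =
      (∏ i ∈ I, (1 - PowerSeries.X) * (U - PowerSeries.C (b i))) *
        ((1 - PowerSeries.X) * (PowerSeries.C p * U + PowerSeries.C q)) := by
    rw [hQ, Finset.prod_mul_distrib, Finset.prod_const]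
    simp only [map_mul, map_prod, map_sub, map_add, aeval_X, aeval_C,
      PowerSeries.algebraMap_apply, Algebra.algebraMap_self, RingHom.id_apply]
    ring
  rw [e3, Finset.prod_congr rfl e1, e2, Finset.prod_mul_distrib, ← map_prod]
  have h5 : PowerSeries.C (∏ i ∈ I, (1 - b i)) * PowerSeries.C (p + q) = (1 : PowerSeries ℝ) := by
    rw [← map_mul, h1', map_one]
  have h6 : ∀ J : Finset ι, ((∏ i ∈ J, (1 - C (b i / (b i - 1)) * X) : ℝ[X]) : PowerSeries ℝ) =
      ∏ i ∈ J, (1 - PowerSeries.C (b i / (b i - 1)) * PowerSeries.X) := by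
    intro J
    rw [← Polynomial.coeToPowerSeries.ringHom_apply, map_prod]
    simp
  simp only [Polynomial.coe_mul, Polynomial.coe_sub, Polynomial.coe_one, Polynomial.coe_C,
    Polynomial.coe_X, h6]
  linear_combination (∏ i ∈ I, (1 - PowerSeries.C (b i / (b i - 1)) * PowerSeries.X)) *
    (1 - PowerSeries.C (q / (p + q)) * PowerSeries.X) * h5

/-- The polynomial `F` with `F (1 / (1 - t)) = 1 + ∑_{n ≥ 1} p (n r) t ^ n`. -/
noncomputable def veronesePoly (p : ℝ[X]) (d r : ℕ) : ℝ[X] :=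
  C (1 - p.eval 0) + ∑ j ∈ Finset.range d, C (p.coeff j * (r : ℝ) ^ j) * powerSumPoly j

theorem natDegree_veronesePoly_le (p : ℝ[X]) (d r : ℕ) : (veronesePoly p d r).natDegree ≤ d := by
  refine (natDegree_add_le _ _).trans (max_le (by simp) ?_)
  refine natDegree_sum_le_of_forall_le _ _ fun j hj => ?_
  refine (natDegree_C_mul_le _ _).trans ?_
  rw [natDegree_powerSumPoly]
  exact Finset.mem_range.1 hj

/-- The point `u = 1` is `t = 0`, so this value is the constant term of the series. The term `1 -
p(0)` in the definition is there to make it `1`. -/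
theorem veronesePoly_eval_one (p : ℝ[X]) {d : ℕ} (hd : 1 ≤ d) (r : ℕ) :
    (veronesePoly p d r).eval 1 = 1 := by
  obtain ⟨d, rfl⟩ : ∃ e, d = e + 1 := ⟨d - 1, by omega⟩
  simp [veronesePoly, Finset.sum_range_succ', eval_finsetSum, powerSumPoly,
    coeff_zero_eq_eval_zero]

theorem aeval_veronesePoly {p : ℝ[X]} {d : ℕ} (hp : p.natDegree < d) (r : ℕ) :
    aeval (PowerSeries.mk 1 : PowerSeries ℝ) (veronesePoly p d r) =
      PowerSeries.mk fun n => if n = 0 then 1 else p.eval ((n * r : ℕ) : ℝ) := by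
  ext n
  simp only [veronesePoly, map_add, map_sum, map_mul (aeval _), aeval_C, aeval_powerSumPoly,
    PowerSeries.algebraMap_apply, Algebra.algebraMap_self, RingHom.id_apply, PowerSeries.coeff_C,
    PowerSeries.coeff_C_mul, PowerSeries.coeff_mk]
  have h : ∑ j ∈ Finset.range d, p.coeff j * (r : ℝ) ^ j * (n : ℝ) ^ j =
      p.eval ((n * r : ℕ) : ℝ) := by
    rw [eval_eq_sum_range' hp]
    refine Finset.sum_congr rfl fun j _ => ?_
    push_cast
    ring
  rw [h]
  split_ifs with hn
  · simp [hn]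
  · simp

/-- Only the top coefficient of `p` survives division by `r^(d-1)`, so up to a scalar the limit
depends on `d` alone. -/
theorem tendsto_veronesePoly (p : ℝ[X]) {d : ℕ} (hd : 2 ≤ d) (x : ℝ) :
    Tendsto (fun r : ℕ => (veronesePoly p d r).eval x / (r : ℝ) ^ (d - 1)) atTop
      (𝓝 (p.coeff (d - 1) * (powerSumPoly (d - 1)).eval x)) := by
  obtain ⟨e, rfl⟩ : ∃ e, d = e + 1 := ⟨d - 1, by omega⟩
  have he : e ≠ 0 := by omega
  rw [Nat.add_sub_cancel]
  have h0 : ∀ j < e, ∀ c : ℝ, Tendsto (fun r : ℕ => c * ((r : ℝ) ^ j / (r : ℝ) ^ e)) atTop (𝓝 0) := by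
    intro j hj c
    have : Tendsto (fun r : ℕ => (r : ℝ) ^ j / (r : ℝ) ^ e) atTop (𝓝 0) :=
      (tendsto_pow_div_pow_atTop_zero hj).comp tendsto_natCast_atTop_atTop
    simpa using this.const_mul c
  have h1 := h0 0 (by omega) (1 - p.eval 0)
  have h2 : Tendsto (fun r : ℕ => ∑ j ∈ Finset.range e,
      (p.coeff j * (powerSumPoly j).eval x) * ((r : ℝ) ^ j / (r : ℝ) ^ e)) atTop
      (𝓝 (∑ j ∈ Finset.range e, (0 : ℝ))) :=
    tendsto_finsetSum _ fun j hj => h0 j (Finset.mem_range.1 hj) _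
  have h3 := (h1.add h2).add_const (p.coeff e * (powerSumPoly e).eval x)
  rw [Finset.sum_const_zero, zero_add, zero_add] at h3
  refine h3.congr' ?_
  filter_upwards [eventually_gt_atTop 0] with r hr
  have hr' : (r : ℝ) ^ e ≠ 0 := by positivity
  simp only [veronesePoly, eval_add, eval_C, eval_finsetSum, eval_mul, Finset.sum_range_succ,
    add_div, Finset.sum_div]
  rw [add_assoc]
  congr 1
  · simp; ring
  · congr 1
    · exact Finset.sum_congr rfl fun j _ => by ring
    · field_simp

/-- Integrality of the numerator: an integer series that becomes a polynomial over `ℝ` has only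
finitely many nonzero coefficients. -/
theorem exists_int_polynomial_of_map_eq {s : PowerSeries ℤ} {P : ℝ[X]}
    (h : s.map (Int.castRingHom ℝ) = (P : PowerSeries ℝ)) :
    ∃ f : ℤ[X], s = (f : PowerSeries ℤ) ∧ f.map (Int.castRingHom ℝ) = P := by
  have hinj : Function.Injective (PowerSeries.map (Int.castRingHom ℝ)) :=
    PowerSeries.map_injective _ Int.cast_injective
  have key : (PowerSeries.trunc (P.natDegree + 1) s).map (Int.castRingHom ℝ) = P := by
    ext n
    have hn := congrArg (PowerSeries.coeff n) h
    rw [PowerSeries.coeff_map, Polynomial.coeff_coe] at hn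
    rw [coeff_map, PowerSeries.coeff_trunc]
    split_ifs with hlt
    · exact hn
    · rw [map_zero, coeff_eq_zero_of_natDegree_lt (by omega)]
  refine ⟨_, hinj ?_, key⟩
  rw [h, ← Polynomial.polynomial_map_coe, key]

/-- The numerators of the Veronese series of an eventually polynomial sequence. -/
theorem exists_veronese_root_limits (d : ℕ) (hd : 2 ≤ d) :
    ∃ α : ℕ → ℝ, (∀ i ∈ Finset.Icc 1 (d - 2), α i < 0) ∧
      ∀ (H : ℕ → ℕ) (p : ℝ[X]) (N : ℕ), p.natDegree = d - 1 →
        (∀ n ≥ N, (H n : ℝ) = p.eval (n : ℝ)) → H 0 = 1 →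
        ∃ R : ℕ, 0 < R ∧ ∃ β : ℕ → ℕ → ℝ,
          (∀ r > R, ∀ i ∈ Finset.Icc 1 (d - 1), β i r < 0) ∧
          (∀ i ∈ Finset.Icc 1 (d - 2), Tendsto (fun r => β i r) atTop (𝓝 (α i))) ∧
          Tendsto (fun r => β (d - 1) r) atTop atBot ∧
          Tendsto (fun r => β d r) atTop (𝓝 0) ∧
          ∀ r > R, ∃ h : ℤ[X],
            (PowerSeries.mk fun n => (H (n * r) : ℤ)) * (1 - PowerSeries.X) ^ d =
              (h : PowerSeries ℤ) ∧
            h.map (Int.castRingHom ℝ) = ∏ i ∈ Finset.Icc 1 d, (1 - C (β i r) * X) := by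
  obtain ⟨v, hvinj, hv01, hvd, hv⟩ := exists_powerSumPoly_simple_roots hd
  set I := (Finset.Icc 1 d).erase (d - 1) with hI
  have hdI : d - 1 ∈ Finset.Icc 1 d := by rw [Finset.mem_Icc]; omega
  have hIcard : I.card + 1 = d := by
    rw [hI, Finset.card_erase_of_mem hdI, Nat.card_Icc]; omega
  have hsub : ∀ i ∈ Finset.Icc 1 (d - 2), i ∈ I := by
    intro i hi
    rw [Finset.mem_Icc] at hi
    rw [hI, Finset.mem_erase, Finset.mem_Icc]
    omega
  have hdmem : d ∈ I := by
    rw [hI, Finset.mem_erase, Finset.mem_Icc]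
    omega
  have hv1 : ∀ i ∈ I, v i ≠ 1 := by
    intro i hi
    rw [hI, Finset.mem_erase, Finset.mem_Icc] at hi
    by_cases h : i = d
    · rw [h, hvd]; norm_num
    · exact (hv01 i (by rw [Finset.mem_Icc]; omega)).2.ne
  have hα : ∀ i ∈ Finset.Icc 1 (d - 2), v i / (v i - 1) < 0 := fun i hi =>
    div_neg_of_pos_of_neg (hv01 i hi).1 (by linarith [(hv01 i hi).2])
  refine ⟨fun i => v i / (v i - 1), hα, fun H p N hp hH hH0 => ?_⟩
  have hp0 : p ≠ 0 := by rintro rfl; rw [natDegree_zero] at hp; omega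
  have hc : p.coeff (d - 1) ≠ 0 := by
    rw [← hp]; exact leadingCoeff_ne_zero.2 hp0
  have hroot : ∀ i, ∃ b : ℕ → ℝ, i ∈ I → Tendsto b atTop (𝓝 (v i)) ∧
      ∀ᶠ r in atTop, (veronesePoly p d r).eval (b r) = 0 := by
    intro i
    by_cases hi : i ∈ I
    · obtain ⟨b, hb, hb0⟩ := exists_tendsto_root
        (f := fun r x => (veronesePoly p d r).eval x / (r : ℝ) ^ (d - 1))
        (g := fun x => p.coeff (d - 1) * (powerSumPoly (d - 1)).eval x) (z := v i)
        (fun r => (Polynomial.continuous _).div_const _) (tendsto_veronesePoly p hd)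
        (by rw [(hv i hi).1, mul_zero])
        (by
          have := ((powerSumPoly (d - 1)).hasDerivAt (v i)).const_mul (p.coeff (d - 1))
          rw [this.deriv]
          exact mul_ne_zero hc (hv i hi).2)
      refine ⟨b, fun _ => ⟨hb, ?_⟩⟩
      filter_upwards [hb0, eventually_gt_atTop 0] with r hr hr0
      exact (div_eq_zero_iff.1 hr).resolve_right (by positivity)
    · exact ⟨0, fun h => absurd h hi⟩
  choose b hb using hroot
  -- At index `d-1` stands the value that the coefficient of `t` will force on the remaining factor.
  let β : ℕ → ℕ → ℝ := fun i r =>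
    if i = d - 1 then d - H r - ∑ j ∈ I, b j r / (b j r - 1) else b i r / (b i r - 1)
  have hβI : ∀ i ∈ I, ∀ r, β i r = b i r / (b i r - 1) := fun i hi r =>
    if_neg (Finset.ne_of_mem_erase hi)
  have hβd : ∀ r, β (d - 1) r = d - H r - ∑ j ∈ I, b j r / (b j r - 1) := fun r => if_pos rfl
  have hlim : ∀ i ∈ I, Tendsto (fun r => b i r / (b i r - 1)) atTop (𝓝 (v i / (v i - 1))) :=
    fun i hi => (hb i hi).1.div ((hb i hi).1.sub_const 1) (sub_ne_zero.2 (hv1 i hi))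
  have hlimβ : ∀ i ∈ I, Tendsto (fun r => β i r) atTop (𝓝 (v i / (v i - 1))) := by
    intro i hi
    simp only [hβI i hi]
    exact hlim i hi
  have hHtop : Tendsto (fun r => (H r : ℝ)) atTop atTop := by
    -- The absolute value avoids discussing the sign of the leading coefficient: `p` agrees with `H
    -- ≥ 0` at large integers.
    have h1 : Tendsto (fun x : ℝ => |p.eval x|) atTop atTop :=
      p.abs_tendsto_atTop (by rw [← natDegree_pos_iff_degree_pos]; omega)
    refine (h1.comp tendsto_natCast_atTop_atTop).congr' ?_
    filter_upwards [eventually_ge_atTop N] with r hr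
    rw [Function.comp_apply, ← hH r hr, abs_of_nonneg (Nat.cast_nonneg _)]
  have hbot : Tendsto (fun r => β (d - 1) r) atTop atBot := by
    simp only [hβd]
    have h2 := tendsto_finsetSum I fun i hi => hlim i hi
    have h3 : Tendsto (fun r => (d : ℝ) - H r) atTop atBot :=
      tendsto_const_nhds.add_atBot (tendsto_neg_atTop_atBot.comp hHtop)
    exact h3.atBot_add h2.neg
  have hneg : ∀ i ∈ Finset.Icc 1 (d - 1), ∀ᶠ r in atTop, β i r < 0 := by
    intro i hi
    by_cases h : i = d - 1
    · rw [h]; exact hbot.eventually_lt_atBot 0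
    · have h' : i ∈ Finset.Icc 1 (d - 2) := by rw [Finset.mem_Icc] at hi ⊢; omega
      exact (hlimβ i (hsub i h')).eventually_lt_const (hα i h')
  have hinj : ∀ i ∈ I, ∀ j ∈ I, ∀ᶠ r in atTop, b i r = b j r → i = j := by
    intro i hi j hj
    by_cases hij : i = j
    · exact Eventually.of_forall fun _ _ => hij
    · have hne : v i ≠ v j := fun h => hij (hvinj hi hj h)
      filter_upwards [((hb i hi).1.sub (hb j hj).1).eventually_ne (sub_ne_zero.2 hne)] with r hr h
      exact absurd (sub_eq_zero.2 h) hr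
  -- With `N ≤ r`, every positive multiple of `r` lies in the range where `H` is polynomial; degree
  -- `0` is covered by `H 0 = 1`.
  have hall : ∀ᶠ r in atTop, (∀ i ∈ Finset.Icc 1 (d - 1), β i r < 0) ∧
      (∀ i ∈ I, (veronesePoly p d r).eval (b i r) = 0) ∧
      (∀ i ∈ I, ∀ j ∈ I, b i r = b j r → i = j) ∧ N ≤ r := by
    refine ((Finset.eventually_all _).2 hneg).and (((Finset.eventually_all _).2
      fun i hi => (hb i hi).2).and (((Finset.eventually_all _).2 fun i hi =>
        (Finset.eventually_all _).2 (hinj i hi)).and (eventually_ge_atTop N)))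
  obtain ⟨R, hR⟩ := eventually_atTop.1 hall
  refine ⟨R + 1, by omega, β, fun r hr => (hR r (by omega)).1, fun i hi => hlimβ i (hsub i hi),
    hbot, ?_, fun r hr => ?_⟩
  · have := hlimβ d hdmem
    rwa [hvd, zero_div] at this
  · obtain ⟨-, hr0, hrinj, hrN⟩ := hR r (by omega)
    set s : PowerSeries ℤ := PowerSeries.mk fun n => (H (n * r) : ℤ) with hs
    have hsmap : s.map (Int.castRingHom ℝ) =
        aeval (PowerSeries.mk 1 : PowerSeries ℝ) (veronesePoly p d r) := by
      rw [aeval_veronesePoly (by omega)]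
      ext n
      rw [PowerSeries.coeff_map, hs, PowerSeries.coeff_mk, PowerSeries.coeff_mk]
      split_ifs with hn
      · simp [hn, hH0]
      · rw [← hH (n * r) (hrN.trans (Nat.le_mul_of_pos_left r (by omega)))]
        simp
    obtain ⟨c, hc⟩ := aeval_mul_one_sub_pow_eq_prod (F := veronesePoly p d r) (I := I)
      (b := fun i => b i r) (by rw [hIcard]; exact natDegree_veronesePoly_le p d r)
      (fun i hi j hj h => hrinj i hi j hj h) hr0 (veronesePoly_eval_one p (by omega) r)
    rw [← hsmap, hIcard] at hc
    have hmap : (s * (1 - PowerSeries.X) ^ d).map (Int.castRingHom ℝ) =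
        s.map (Int.castRingHom ℝ) * (1 - PowerSeries.X) ^ d := by
      simp
    rw [← hmap] at hc
    have hcoeff := congrArg (PowerSeries.coeff 1) hc
    -- The coefficient of `t` is `H(r) - d` on the left and minus the sum of all parameters on the
    -- right.
    have hcβ : c = β (d - 1) r := by
      have h1 : (PowerSeries.coeff 1) (s * (1 - PowerSeries.X) ^ d) = (H r : ℤ) - d := by
        have h2 : (1 - PowerSeries.X : PowerSeries ℤ) ^ d =
            ((∏ _i ∈ Finset.range d, (1 - C (1 : ℤ) * X) : ℤ[X]) : PowerSeries ℤ) := by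
          rw [Finset.prod_const, Finset.card_range]
          simp
        obtain ⟨h3, h3'⟩ := coeff_one_prod_one_sub (Finset.range d) (fun _ => (1 : ℤ))
        rw [h2]
        generalize (∏ _i ∈ Finset.range d, (1 - C (1 : ℤ) * X) : ℤ[X]) = P at h3 h3'
        rw [PowerSeries.coeff_mul, Finset.Nat.antidiagonal_succ]
        simp only [Finset.Nat.antidiagonal_zero, Finset.map_singleton, Finset.sum_cons,
          Finset.sum_singleton, Polynomial.coeff_coe, hs, PowerSeries.coeff_mk,
          Function.Embedding.prodMap, Function.Embedding.coeFn_mk, Prod.map_apply,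
          Function.Embedding.refl_apply]
        simp [h3, h3', hH0]
        ring
      have h4 := coeff_one_prod_one_sub I (fun i => b i r / (b i r - 1))
      rw [PowerSeries.coeff_map, h1, Polynomial.coeff_coe, mul_coeff_one, h4.1, h4.2] at hcoeff
      simp [coeff_one] at hcoeff
      rw [hβd]
      linarith
    obtain ⟨h, hh, hhmap⟩ := exists_int_polynomial_of_map_eq hc
    refine ⟨h, hh, ?_⟩
    rw [hhmap, ← Finset.prod_erase_mul _ _ hdI, ← hI, hcβ]
    congr 1
    exact Finset.prod_congr rfl fun i hi => by rw [hβI i hi]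

end Numerators

/-! ### Hilbert–Serre theorem, by subquotients `P/Q` of `A`. -/

section HilbertSerre

open DirectSum

variable {k A : Type*} [Field k] [CommRing A] [Algebra k A] (𝒜 : ℕ → Submodule k A)

/-- The component of degree `n` of an ideal. -/
def gradedPart (P : Ideal A) (n : ℕ) : Submodule k A := P.restrictScalars k ⊓ 𝒜 n

theorem mem_gradedPart {P : Ideal A} {n : ℕ} {a : A} :
    a ∈ gradedPart 𝒜 P n ↔ a ∈ P ∧ a ∈ 𝒜 n := Iff.rfl

theorem gradedPart_mono {Q P : Ideal A} (h : Q ≤ P) (n : ℕ) :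
    gradedPart 𝒜 Q n ≤ gradedPart 𝒜 P n := fun _ ha => ⟨h ha.1, ha.2⟩

variable [GradedAlgebra 𝒜]

theorem span_pow_le_graded {s : Set A} (hs : s ⊆ 𝒜 1) (n : ℕ) :
    Submodule.span k s ^ n ≤ 𝒜 n := by
  induction n with
  | zero =>
    rw [pow_zero, Submodule.one_le]
    exact SetLike.GradedOne.one_mem
  | succ n ih =>
    rw [pow_succ, Submodule.mul_le]
    intro a ha b hb
    exact SetLike.GradedMul.mul_mem (ih ha) (Submodule.span_le.2 hs hb)

theorem graded_eq_span_pow {s : Set A} (hs : s ⊆ 𝒜 1) (hgen : Algebra.adjoin k s = ⊤) (n : ℕ) :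
    𝒜 n = Submodule.span k s ^ n := by
  refine le_antisymm (fun x hx => ?_) (span_pow_le_graded 𝒜 hs n)
  have hmon : ∀ y ∈ Submonoid.closure s, ∃ m, y ∈ Submodule.span k s ^ m := by
    intro y hy
    induction hy using Submonoid.closure_induction with
    | mem y hy => exact ⟨1, by rw [pow_one]; exact Submodule.subset_span hy⟩
    | one => exact ⟨0, by rw [pow_zero]; exact Submodule.one_le.1 le_rfl⟩
    | mul y z _ _ hy hz =>
      obtain ⟨m, hm⟩ := hy
      obtain ⟨l, hl⟩ := hz
      exact ⟨m + l, by rw [pow_add]; exact Submodule.mul_mem_mul hm hl⟩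
  have key : ∀ y ∈ Submodule.span k (Submonoid.closure s : Set A),
      (decompose 𝒜 y n : A) ∈ Submodule.span k s ^ n := by
    intro y hy
    induction hy using Submodule.span_induction with
    | mem y hy =>
      obtain ⟨m, hm⟩ := hmon y hy
      have hm' := span_pow_le_graded 𝒜 hs m hm
      by_cases hmn : m = n
      · subst hmn
        rwa [decompose_of_mem_same 𝒜 hm']
      · rw [decompose_of_mem_ne 𝒜 hm' hmn]
        exact zero_mem _
    | zero => simp
    | add y z _ _ hy hz => rw [decompose_add]; exact add_mem hy hz
    | smul c y _ hy => rw [decompose_smul]; exact Submodule.smul_mem _ c hy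
  have hx' : x ∈ Submodule.span k (Submonoid.closure s : Set A) := by
    rw [← Algebra.adjoin_eq_span, hgen]
    trivial
  simpa only [decompose_of_mem_same 𝒜 hx] using key x hx'

theorem finite_graded {s : Set A} (hfin : s.Finite) (hs : s ⊆ 𝒜 1)
    (hgen : Algebra.adjoin k s = ⊤) (n : ℕ) : Module.Finite k (𝒜 n) := by
  rw [Module.Finite.iff_fg, graded_eq_span_pow 𝒜 hs hgen n]
  exact (Submodule.fg_span hfin).pow n

/-- The elements of `P` that `x` multiplies into `Q`. -/
def mulComap (Q P : Ideal A) (x : A) : Ideal A := P ⊓ Submodule.comap (LinearMap.mulLeft A x) Q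

theorem mem_mulComap {Q P : Ideal A} {x a : A} : a ∈ mulComap Q P x ↔ a ∈ P ∧ x * a ∈ Q := Iff.rfl

theorem isHomogeneous_mulComap {Q P : Ideal A} (hQ : Q.IsHomogeneous 𝒜) (hP : P.IsHomogeneous 𝒜)
    {x : A} (hx : x ∈ 𝒜 1) : (mulComap Q P x).IsHomogeneous 𝒜 := by
  intro i a ha
  rw [mem_mulComap] at ha ⊢
  refine ⟨hP i ha.1, ?_⟩
  rw [← coe_decompose_mul_add_of_left_mem 𝒜 hx]
  exact hQ _ ha.2

theorem isHomogeneous_sup_span_mul {Q P : Ideal A} (hQ : Q.IsHomogeneous 𝒜)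
    (hP : P.IsHomogeneous 𝒜) {x : A} (hx : x ∈ 𝒜 1) :
    (Q ⊔ Ideal.span {x} * P).IsHomogeneous 𝒜 := by
  refine hQ.sup (Ideal.IsHomogeneous.mul (Ideal.homogeneous_span 𝒜 _ ?_) hP)
  rintro y rfl
  exact ⟨1, hx⟩

theorem gradedPart_sup_zero {Q P : Ideal A} (hQ : Q.IsHomogeneous 𝒜) {x : A} (hx : x ∈ 𝒜 1) :
    gradedPart 𝒜 (Q ⊔ Ideal.span {x} * P) 0 = gradedPart 𝒜 Q 0 := by
  refine le_antisymm ?_ (gradedPart_mono 𝒜 le_sup_left 0)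
  rintro a ⟨ha, ha0⟩
  obtain ⟨q, hq, y, hy, rfl⟩ := Submodule.mem_sup.1 (show a ∈ Q ⊔ Ideal.span {x} * P from ha)
  obtain ⟨z, -, rfl⟩ := Ideal.mem_span_singleton_mul.1 hy
  refine ⟨?_, ha0⟩
  rw [← decompose_of_mem_same 𝒜 ha0, decompose_add, DirectSum.add_apply, Submodule.coe_add,
    coe_decompose_mul_of_left_mem_of_not_le 𝒜 hx (by omega), add_zero]
  exact hQ 0 hq

/-- With `J = Q + xP`, multiplication by `x` on `P_n` and the inclusion of `J_{n+1}` have the same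
image in `A/Q`. Rank–nullity for both maps gives the identity. -/
theorem finrank_gradedPart_succ [∀ n, Module.Finite k (𝒜 n)] {Q P : Ideal A}
    (hQ : Q.IsHomogeneous 𝒜) (hP : P.IsHomogeneous 𝒜) {x : A} (hx : x ∈ 𝒜 1) (n : ℕ) :
    Module.finrank k (gradedPart 𝒜 (Q ⊔ Ideal.span {x} * P) (n + 1)) +
        Module.finrank k (gradedPart 𝒜 (mulComap Q P x) n) =
      Module.finrank k (gradedPart 𝒜 Q (n + 1)) + Module.finrank k (gradedPart 𝒜 P n) := by
  have hfd : ∀ (I : Ideal A) (m : ℕ), Module.Finite k (gradedPart 𝒜 I m) := fun I m =>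
    Submodule.finiteDimensional_of_le (inf_le_right : gradedPart 𝒜 I m ≤ 𝒜 m)
  have := hfd
  set J := Q ⊔ Ideal.span {x} * P with hJ
  let π : A →ₗ[k] A ⧸ Q.restrictScalars k := (Q.restrictScalars k).mkQ
  have hπ : ∀ a, π a = 0 ↔ a ∈ Q := fun a => Submodule.Quotient.mk_eq_zero _
  let f : gradedPart 𝒜 P n →ₗ[k] A ⧸ Q.restrictScalars k :=
    (π ∘ₗ LinearMap.mulLeft k x) ∘ₗ (gradedPart 𝒜 P n).subtype
  let g : gradedPart 𝒜 J (n + 1) →ₗ[k] A ⧸ Q.restrictScalars k :=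
    π ∘ₗ (gradedPart 𝒜 J (n + 1)).subtype
  have hf : f.ker = Submodule.comap (gradedPart 𝒜 P n).subtype
      (gradedPart 𝒜 (mulComap Q P x) n) := by
    ext a
    have h1 : f a = π (x * a) := rfl
    rw [LinearMap.mem_ker, h1, hπ, Submodule.mem_comap, mem_gradedPart, mem_mulComap]
    exact ⟨fun h => ⟨⟨a.2.1, h⟩, a.2.2⟩, fun h => h.1.2⟩
  have hg : g.ker = Submodule.comap (gradedPart 𝒜 J (n + 1)).subtype
      (gradedPart 𝒜 Q (n + 1)) := by
    ext a
    have h1 : g a = π a := rfl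
    rw [LinearMap.mem_ker, h1, hπ, Submodule.mem_comap, mem_gradedPart]
    exact ⟨fun h => ⟨h, a.2.2⟩, fun h => h.1⟩
  have hrange : f.range = g.range := by
    apply le_antisymm
    · rintro _ ⟨a, rfl⟩
      refine ⟨⟨x * a, ?_, ?_⟩, rfl⟩
      · exact Ideal.mem_sup_right (Ideal.mul_mem_mul (Ideal.mem_span_singleton_self x) a.2.1)
      · rw [add_comm]
        exact SetLike.GradedMul.mul_mem hx a.2.2
    · rintro _ ⟨⟨a, ha, han⟩, rfl⟩
      obtain ⟨q, hq, y, hy, rfl⟩ := Submodule.mem_sup.1 (show a ∈ J from ha)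
      obtain ⟨z, hz, rfl⟩ := Ideal.mem_span_singleton_mul.1 hy
      refine ⟨⟨decompose 𝒜 z n, hP n hz, SetLike.coe_mem _⟩, ?_⟩
      change π (x * (decompose 𝒜 z n : A)) = π (q + x * z)
      symm
      rw [← sub_eq_zero, ← map_sub, hπ, ← decompose_of_mem_same 𝒜 han, decompose_add,
        DirectSum.add_apply, Submodule.coe_add, add_comm n 1,
        coe_decompose_mul_add_of_left_mem 𝒜 hx, add_sub_cancel_right]
      exact hQ _ hq
  have e1 := LinearMap.finrank_range_add_finrank_ker f
  have e2 := LinearMap.finrank_range_add_finrank_ker g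
  rw [hf, (Submodule.comapSubtypeEquivOfLe (gradedPart_mono 𝒜 (Q := mulComap Q P x) (P := P)
    inf_le_left n)).finrank_eq] at e1
  rw [hg, (Submodule.comapSubtypeEquivOfLe (gradedPart_mono 𝒜 (Q := Q) (P := J)
    le_sup_left (n + 1))).finrank_eq] at e2
  rw [hrange] at e1
  omega

/-- By noetherianity `P` is generated in degrees at most `D` as far as its homogeneous elements are
concerned. Beyond `D` such elements are combinations of these generators with coefficients of
positive degree, which carry `P` into `Q`. -/
theorem gradedPart_eventually_eq {s : Set A} (hs : s ⊆ 𝒜 1) (hgen : Algebra.adjoin k s = ⊤)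
    [IsNoetherianRing A] {Q P : Ideal A} (hQP : Q ≤ P) (hsP : ∀ x ∈ s, ∀ a ∈ P, x * a ∈ Q) :
    ∃ D, ∀ n > D, gradedPart 𝒜 P n = gradedPart 𝒜 Q n := by
  have hpos : ∀ m, ∀ a ∈ 𝒜 (m + 1), ∀ p ∈ P, a * p ∈ Q := by
    intro m a ha p hp
    rw [graded_eq_span_pow 𝒜 hs hgen, pow_succ] at ha
    refine Submodule.mul_induction_on ha (fun b _ c hc => ?_) (fun b c hb hc => ?_)
    · rw [mul_assoc]
      refine Q.mul_mem_left b ?_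
      induction hc using Submodule.span_induction with
      | mem c hc => exact hsP c hc p hp
      | zero => simp
      | add c c' _ _ h h' => rw [add_mul]; exact add_mem h h'
      | smul t c _ h => rw [smul_mul_assoc]; exact Submodule.smul_of_tower_mem Q t h
    · rw [add_mul]
      exact add_mem hb hc
  let I : ℕ →o Ideal A := ⟨fun D => Ideal.span {a | ∃ n ≤ D, a ∈ gradedPart 𝒜 P n}, by
    intro D E hDE
    refine Ideal.span_mono ?_
    rintro a ⟨n, hn, ha⟩
    exact ⟨n, hn.trans hDE, ha⟩⟩
  obtain ⟨D, hD⟩ := monotone_stabilizes_iff_noetherian.2 (inferInstanceAs (IsNoetherian A A)) I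
  refine ⟨D, fun n hn => le_antisymm (fun a ha => ⟨?_, ha.2⟩) (gradedPart_mono 𝒜 hQP n)⟩
  have haI : a ∈ I D := by
    rw [hD n hn.le]
    exact Ideal.subset_span ⟨n, le_rfl, ha⟩
  have key : ∀ z ∈ I D, (decompose 𝒜 z n : A) ∈ Q := by
    intro z hz
    induction hz using Submodule.closure_induction with
    | zero => simp
    | add y z _ _ hy hz => rw [decompose_add]; exact add_mem hy hz
    | smul_mem b y hy =>
      obtain ⟨j, hj, hyP, hyj⟩ := hy
      rw [smul_eq_mul, coe_decompose_mul_of_right_mem_of_le 𝒜 hyj (by omega)]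
      obtain ⟨m, hm⟩ : ∃ m, n - j = m + 1 := ⟨n - j - 1, by omega⟩
      rw [hm]
      exact hpos m _ (SetLike.coe_mem _) y hyP
  have := key a haI
  rwa [decompose_of_mem_same 𝒜 ha.2] at this

/-- The generating series of the dimensions of the components of an ideal. -/
noncomputable def idealSeries (P : Ideal A) : PowerSeries ℤ :=
  GradedHilbert.hilbertSeries (gradedPart 𝒜 P)

theorem idealSeries_sup [∀ n, Module.Finite k (𝒜 n)] {Q P : Ideal A}
    (hQ : Q.IsHomogeneous 𝒜) (hP : P.IsHomogeneous 𝒜) {x : A} (hx : x ∈ 𝒜 1) :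
    idealSeries 𝒜 (Q ⊔ Ideal.span {x} * P) = idealSeries 𝒜 Q +
      PowerSeries.X * (idealSeries 𝒜 P - idealSeries 𝒜 (mulComap Q P x)) := by
  ext n
  cases n with
  | zero =>
    simp only [idealSeries, GradedHilbert.hilbertSeries, map_add, PowerSeries.coeff_mk,
      PowerSeries.coeff_zero_X_mul, add_zero]
    rw [gradedPart_sup_zero 𝒜 hQ hx]
  | succ n =>
    have h := finrank_gradedPart_succ 𝒜 hQ hP hx n
    rw [map_add, PowerSeries.coeff_succ_X_mul, map_sub]
    simp only [idealSeries, GradedHilbert.hilbertSeries, PowerSeries.coeff_mk]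
    omega

/-- Induction on the set `T` of generators allowed to act nontrivially on `P/Q`. The kernel and
cokernel of `x` on `P/Q` are killed by `x` and are again quotients of homogeneous ideals, so pairs
`Q ≤ P` suffice and no graded modules are needed. -/
theorem exists_idealSeries_sub_mul_eq {s : Set A} (hs : s ⊆ 𝒜 1) (hgen : Algebra.adjoin k s = ⊤)
    [IsNoetherianRing A] [∀ n, Module.Finite k (𝒜 n)] (T : Finset A) (hT : ∀ x ∈ T, x ∈ 𝒜 1) :
    ∀ Q P : Ideal A, Q ≤ P → Q.IsHomogeneous 𝒜 → P.IsHomogeneous 𝒜 →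
      (∀ x ∈ s, x ∉ T → ∀ a ∈ P, x * a ∈ Q) → ∃ f : Polynomial ℤ,
        (idealSeries 𝒜 P - idealSeries 𝒜 Q) * (1 - PowerSeries.X) ^ T.card =
          (f : PowerSeries ℤ) := by
  classical
  induction T using Finset.induction_on with
  | empty =>
    intro Q P hQP hQ hP h
    obtain ⟨D, hD⟩ := gradedPart_eventually_eq 𝒜 hs hgen hQP
      (fun x hx => h x hx (Finset.notMem_empty x))
    refine ⟨PowerSeries.trunc (D + 1) (idealSeries 𝒜 P - idealSeries 𝒜 Q), ?_⟩
    rw [Finset.card_empty, pow_zero, mul_one]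
    ext n
    rw [Polynomial.coeff_coe, PowerSeries.coeff_trunc]
    split_ifs with hn
    · rfl
    · simp only [map_sub, idealSeries, GradedHilbert.hilbertSeries, PowerSeries.coeff_mk]
      rw [hD n (by omega), sub_self]
  | insert x T hxT ih =>
    intro Q P hQP hQ hP h
    have hx : x ∈ 𝒜 1 := hT x (Finset.mem_insert_self x T)
    have ih' := ih fun y hy => hT y (Finset.mem_insert_of_mem hy)
    have hmul : ∀ a ∈ P, ∀ y ∈ s, y ∉ T → y ≠ x → y * a ∈ Q := fun a ha y hy hyT hyx =>
      h y hy (by rw [Finset.mem_insert]; tauto) a ha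
    obtain ⟨f, hf⟩ := ih' (Q ⊔ Ideal.span {x} * P) P (sup_le hQP Ideal.mul_le_right)
      (isHomogeneous_sup_span_mul 𝒜 hQ hP hx) hP (by
        intro y hy hyT a ha
        by_cases hyx : y = x
        · subst hyx
          exact Ideal.mem_sup_right (Ideal.mul_mem_mul (Ideal.mem_span_singleton_self y) ha)
        · exact Ideal.mem_sup_left (hmul a ha y hy hyT hyx))
    obtain ⟨g, hg⟩ := ih' Q (mulComap Q P x) (fun a ha => ⟨hQP ha, Q.mul_mem_left x ha⟩) hQ
      (isHomogeneous_mulComap 𝒜 hQ hP hx) (by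
        intro y hy hyT a ha
        by_cases hyx : y = x
        · subst hyx
          exact ha.2
        · exact hmul a ha.1 y hy hyT hyx)
    -- The cokernel contributes `f`; the kernel contributes `g`, shifted by one degree.
    refine ⟨f - Polynomial.X * g, ?_⟩
    rw [idealSeries_sup 𝒜 hQ hP hx] at hf
    rw [Finset.card_insert_of_notMem hxT, pow_succ, Polynomial.coe_sub, Polynomial.coe_mul,
      Polynomial.coe_X, ← hf, ← hg]
    ring

/-- **Hilbert–Serre theorem** for standard graded algebras. -/
theorem exists_hilbertSeries_mul_eq (h : GradedHilbert.IsStandardGraded 𝒜) :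
    ∃ (m : ℕ) (f : Polynomial ℤ),
      GradedHilbert.hilbertSeries 𝒜 * (1 - PowerSeries.X) ^ m = (f : PowerSeries ℤ) := by
  obtain ⟨s, hs, hgen⟩ := h.fg_degree_one
  have : Algebra.FiniteType k A := ⟨⟨s, hgen⟩⟩
  have : IsNoetherianRing A := Algebra.FiniteType.isNoetherianRing k A
  have := finite_graded 𝒜 s.finite_toSet hs hgen
  obtain ⟨f, hf⟩ := exists_idealSeries_sub_mul_eq 𝒜 (s := (s : Set A)) hs hgen s hs ⊥ ⊤ bot_le
    (Ideal.IsHomogeneous.bot 𝒜) (Ideal.IsHomogeneous.top 𝒜) (fun x hx hx' => absurd hx hx')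
  refine ⟨s.card, f, ?_⟩
  rw [← hf]
  congr 1
  ext n
  have h1 : gradedPart 𝒜 ⊤ n = 𝒜 n := le_antisymm inf_le_right fun a ha => ⟨trivial, ha⟩
  have h2 : gradedPart 𝒜 ⊥ n = ⊥ := le_bot_iff.1 fun a ha => ha.1
  simp only [map_sub, idealSeries, GradedHilbert.hilbertSeries, PowerSeries.coeff_mk]
  rw [h1, h2, finrank_bot, Nat.cast_zero, sub_zero]

theorem exists_hilbert_polynomial (h : GradedHilbert.IsStandardGraded 𝒜) :
    ∃ (p : Polynomial ℝ) (N : ℕ), ∀ n ≥ N, (Module.finrank k (𝒜 n) : ℝ) = p.eval (n : ℝ) := by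
  obtain ⟨m, f, hf⟩ := exists_hilbertSeries_mul_eq 𝒜 h
  set g := f.map (Int.castRingHom ℝ)
  refine ⟨Polynomial.hilbertPoly g m, g.natDegree + 1, fun n hn => ?_⟩
  rw [← Polynomial.coeff_mul_invOneSubPow_eq_hilbertPoly_eval m (by omega)]
  have h1 : (GradedHilbert.hilbertSeries 𝒜).map (Int.castRingHom ℝ) *
      (1 - PowerSeries.X) ^ m = (g : PowerSeries ℝ) := by
    rw [Polynomial.polynomial_map_coe, ← hf]
    simp
  have h2 : (1 - PowerSeries.X) ^ m * (PowerSeries.invOneSubPow ℝ m).val = 1 := by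
    rw [← PowerSeries.invOneSubPow_inv_eq_one_sub_pow]
    exact (PowerSeries.invOneSubPow ℝ m).inv_val
  rw [← h1, mul_assoc, h2, mul_one]
  simp [GradedHilbert.hilbertSeries]

end HilbertSerre

/-! ### Krull dimension and growth of finite extensions of polynomial rings. -/

theorem ringKrullDim_eq_of_isIntegral {R S : Type*} [CommRing R] [CommRing S] [Algebra R S]
    [Algebra.IsIntegral R S] [FaithfulSMul R S] : ringKrullDim S = ringKrullDim R := by
  apply le_antisymm
  -- Incomparability makes contraction of primes strictly monotone. The converse inequality lifts
  -- chains by lying over and going up.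
  · refine Order.krullDim_le_of_strictMono (PrimeSpectrum.comap (algebraMap R S)) fun I J hIJ => ?_
    exact Ideal.IsIntegral.comap_lt_comap (R := R) (I := I.asIdeal) (J := J.asIdeal) hIJ
  · refine iSup_le fun l => ?_
    obtain ⟨Q, hQ, hQl⟩ := Ideal.nonempty_primesOver (S := S) l.head.asIdeal
    obtain ⟨L, hL, -⟩ := Ideal.exists_ltSeries_of_hasGoingUp l Q
    rw [← hL]
    exact Order.LTSeries.length_le_krullDim L

section Growth

open DirectSum

theorem finrank_mul_le_finrank_mul {k A : Type*} [Field k] [CommRing A] [Algebra k A]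
    (M N : Submodule k A) [Module.Finite k M] [Module.Finite k N] :
    Module.finrank k (M * N : Submodule k A) ≤ Module.finrank k M * Module.finrank k N := by
  rw [← Submodule.mulMap_range, ← Module.finrank_tensorProduct (R := k) (S := k)]
  exact LinearMap.finrank_range_le _

variable {k : Type*} [Field k]

/-- Bounding each exponent separately, rather than the total degree, makes the dimension an exact
power. -/
theorem finite_restrictDegree (s m : ℕ) :
    Module.Finite k (MvPolynomial.restrictDegree (Fin s) k m) ∧
      Module.finrank k (MvPolynomial.restrictDegree (Fin s) k m) = (m + 1) ^ s := by
  let e : {n : Fin s →₀ ℕ | ∀ i, n i ≤ m} ≃ (Fin s → Fin (m + 1)) :=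
    { toFun := fun n i => ⟨n.1 i, Nat.lt_succ_of_le (n.2 i)⟩
      invFun := fun f => ⟨Finsupp.equivFunOnFinite.symm fun i => (f i : ℕ), fun i => by
        simpa using Nat.le_of_lt_succ (f i).2⟩
      left_inv := fun n => by ext i; simp
      right_inv := fun f => by ext i; simp }
  have b : Module.Basis (Fin s → Fin (m + 1)) k (MvPolynomial.restrictDegree (Fin s) k m) :=
    (MvPolynomial.basisRestrictSupport k _).reindex e
  exact ⟨Module.Finite.of_basis b, by rw [Module.finrank_eq_card_basis b]; simp⟩

theorem restrictDegree_mul_le (s a b : ℕ) :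
    MvPolynomial.restrictDegree (Fin s) k a * MvPolynomial.restrictDegree (Fin s) k b ≤
      MvPolynomial.restrictDegree (Fin s) k (a + b) := by
  rw [MvPolynomial.restrictDegree, MvPolynomial.restrictDegree,
    ← MvPolynomial.restrictSupport_add]
  refine MvPolynomial.restrictSupport_mono (R := k) ?_
  rintro _ ⟨x, hx, y, hy, rfl⟩ i
  exact add_le_add (hx i) (hy i)

theorem restrictDegree_mono (s : ℕ) {a b : ℕ} (h : a ≤ b) :
    MvPolynomial.restrictDegree (Fin s) k a ≤ MvPolynomial.restrictDegree (Fin s) k b :=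
  MvPolynomial.restrictSupport_mono (R := k) fun _ hx i => (hx i).trans h

theorem exists_mem_restrictDegree {s : ℕ} (p : MvPolynomial (Fin s) k) :
    ∃ m, p ∈ MvPolynomial.restrictDegree (Fin s) k m :=
  ⟨p.totalDegree, (MvPolynomial.mem_restrictDegree _ _ _).2 fun _ hn i =>
    (Finsupp.le_degree i _).trans (MvPolynomial.le_totalDegree hn)⟩

variable {A : Type*} [CommRing A] [Algebra k A]

theorem one_le_span_insert_one (s : Set A) : 1 ≤ Submodule.span k (insert 1 s) :=
  Submodule.one_le.2 (Submodule.subset_span (Set.mem_insert _ _))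

theorem span_insert_one_pow_mono (s : Set A) {m n : ℕ} (h : m ≤ n) :
    Submodule.span k (insert 1 s) ^ m ≤ Submodule.span k (insert 1 s) ^ n :=
  pow_le_pow_right' (one_le_span_insert_one s) h

section

variable (𝒜 : ℕ → Submodule k A) [GradedAlgebra 𝒜]

theorem sum_finrank_le (n : ℕ) (M : Submodule k A) [Module.Finite k M] (h : ∀ i ≤ n, 𝒜 i ≤ M)
    [∀ n, Module.Finite k (𝒜 n)] :
    ∑ i ∈ Finset.range (n + 1), Module.finrank k (𝒜 i) ≤ Module.finrank k M := by
  let f : (∀ i : Fin (n + 1), 𝒜 i) →ₗ[k] A :=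
    ∑ i : Fin (n + 1), (𝒜 i).subtype ∘ₗ LinearMap.proj i
  have hf : ∀ a, f a = ∑ i, (a i : A) := fun a => by simp [f]
  have hfM : ∀ a, f a ∈ M := fun a => by
    rw [hf]
    exact sum_mem fun i _ => h i (Nat.le_of_lt_succ i.2) (a i).2
  have hdec : ∀ a (j : Fin (n + 1)), decompose 𝒜 (f a) j = a j := by
    intro a j
    rw [hf, decompose_sum, DFinsupp.finsetSum_apply, Finset.sum_eq_single j]
    · simp
    · intro i _ hij
      rw [decompose_coe, of_eq_of_ne]
      exact fun h => hij (Fin.ext h.symm)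
    · simp
  have hinj : Function.Injective (f.codRestrict M hfM) := by
    intro a b hab
    have hab' : f a = f b := congrArg Subtype.val hab
    ext j
    rw [← hdec a j, ← hdec b j, hab']
  have := LinearMap.finrank_le_finrank_of_injective hinj
  rwa [Module.finrank_pi_fintype, Fin.sum_univ_eq_sum_range (fun i => Module.finrank k (𝒜 i))]
    at this

theorem finrank_le_sum (n : ℕ) (M : Submodule k A)
    (h : ∀ a ∈ M, ∀ i > n, decompose 𝒜 a i = 0) [∀ n, Module.Finite k (𝒜 n)] :
    Module.finrank k M ≤ ∑ i ∈ Finset.range (n + 1), Module.finrank k (𝒜 i) := by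
  let f : M →ₗ[k] (∀ i : Fin (n + 1), 𝒜 i) := LinearMap.pi fun i =>
    DirectSum.component k ℕ (fun i => 𝒜 i) i ∘ₗ (decomposeLinearEquiv 𝒜).toLinearMap ∘ₗ M.subtype
  have hf : ∀ a i, f a i = decompose 𝒜 (a : A) i := fun a i => rfl
  have hinj : Function.Injective f := by
    rw [injective_iff_map_eq_zero]
    intro a ha
    apply Subtype.ext
    apply (decompose 𝒜).injective
    rw [ZeroMemClass.coe_zero, decompose_zero]
    ext i : 1
    by_cases hi : i ≤ n
    · have h1 := congrFun ha (⟨i, Nat.lt_succ_of_le hi⟩ : Fin (n + 1))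
      rw [hf] at h1
      exact h1
    · exact h a a.2 i (by omega)
  have := LinearMap.finrank_le_finrank_of_injective hinj
  rwa [Module.finrank_pi_fintype, Fin.sum_univ_eq_sum_range (fun i => Module.finrank k (𝒜 i))]
    at this

theorem decompose_eq_zero_of_mem_span_pow {s : Set A} (hs : s ⊆ 𝒜 1) (n : ℕ) :
    ∀ a ∈ Submodule.span k (insert 1 s) ^ n, ∀ i > n, decompose 𝒜 a i = 0 := by
  induction n with
  | zero =>
    intro a ha i hi
    rw [pow_zero, Submodule.mem_one] at ha
    obtain ⟨c, rfl⟩ := ha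
    have h0 : algebraMap k A c ∈ 𝒜 0 := SetLike.algebraMap_mem_graded 𝒜 c
    exact Subtype.ext (decompose_of_mem_ne 𝒜 h0 (by omega))
  | succ n ih =>
    intro a ha i hi
    rw [pow_succ] at ha
    refine Submodule.mul_induction_on ha (fun b hb v hv => ?_) (fun b c hb hc => ?_)
    · induction hv using Submodule.span_induction with
      | mem v hv =>
        rcases hv with rfl | hv
        · rw [mul_one]
          exact ih b hb i (by omega)
        · apply Subtype.ext
          rw [coe_decompose_mul_of_right_mem_of_le 𝒜 (hs hv) (by omega),
            ih b hb (i - 1) (by omega)]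
          simp
      | zero => simp
      | add v w _ _ h h' => rw [mul_add, decompose_add, DirectSum.add_apply, h, h', add_zero]
      | smul t v _ h => rw [mul_smul_comm, decompose_smul, DirectSum.smul_apply, h, smul_zero]
    · rw [decompose_add, DirectSum.add_apply, hb, hc, add_zero]

theorem graded_le_span_insert_one_pow {s : Set A} (hs : s ⊆ 𝒜 1) (hgen : Algebra.adjoin k s = ⊤)
    {i n : ℕ} (h : i ≤ n) : 𝒜 i ≤ Submodule.span k (insert 1 s) ^ n := by
  rw [graded_eq_span_pow 𝒜 hs hgen]
  exact (pow_le_pow_left' (Submodule.span_mono (Set.subset_insert _ _)) i).trans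
    (span_insert_one_pow_mono s h)

theorem exists_mem_span_insert_one_pow {s : Set A} (hs : s ⊆ 𝒜 1)
    (hgen : Algebra.adjoin k s = ⊤) (a : A) :
    ∃ n, a ∈ Submodule.span k (insert 1 s) ^ n := by
  classical
  refine ⟨(decompose 𝒜 a).support.sup id, ?_⟩
  have h : ∑ i ∈ (decompose 𝒜 a).support, (decompose 𝒜 a i : A) ∈
      Submodule.span k (insert 1 s) ^ (decompose 𝒜 a).support.sup id :=
    sum_mem fun i hi => graded_le_span_insert_one_pow 𝒜 hs hgen
      (Finset.le_sup (f := id) hi) (SetLike.coe_mem _)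
  rwa [sum_support_decompose] at h

/-- Adjoining `1` to the generators turns the grading into a multiplicative filtration. This is
needed because the normalization map need not respect degrees. -/
theorem finrank_span_insert_one_pow {s : Set A} (hfin : s.Finite) (hs : s ⊆ 𝒜 1)
    (hgen : Algebra.adjoin k s = ⊤) (n : ℕ) :
    Module.finrank k (Submodule.span k (insert 1 s) ^ n : Submodule k A) =
      ∑ i ∈ Finset.range (n + 1), Module.finrank k (𝒜 i) := by
  have := finite_graded 𝒜 hfin hs hgen
  have : Module.Finite k (Submodule.span k (insert 1 s) ^ n : Submodule k A) :=
    Module.Finite.iff_fg.2 ((Submodule.fg_span (hfin.insert 1)).pow n)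
  exact le_antisymm (finrank_le_sum 𝒜 n _ (decompose_eq_zero_of_mem_span_pow 𝒜 hs n))
    (sum_finrank_le 𝒜 n _ fun i hi => graded_le_span_insert_one_pow 𝒜 hs hgen hi)

/-- An embedded polynomial ring bounds the growth of a graded algebra from below. -/
theorem exists_growth_lower_bound {s : Set A} (hfin : s.Finite) (hs : s ⊆ 𝒜 1)
    (hgen : Algebra.adjoin k s = ⊤) {d : ℕ} (g : MvPolynomial (Fin d) k →ₐ[k] A)
    (hg : Function.Injective g) :
    ∃ c, ∀ m, (m + 1) ^ d ≤ ∑ i ∈ Finset.range (c * m + 1), Module.finrank k (𝒜 i) := by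
  set W := Submodule.span k (insert 1 s) with hW
  choose e he using fun i => exists_mem_span_insert_one_pow 𝒜 hs hgen (g (MvPolynomial.X i))
  set c := Finset.univ.sup e
  -- Each `g(X_i)` lies in `W^c`, so a monomial in `d` variables with exponents at most `m` lands in
  -- `W^(cdm)`.
  refine ⟨c * d, fun m => ?_⟩
  have hle : (MvPolynomial.restrictDegree (Fin d) k m).map g.toLinearMap ≤ W ^ (c * d * m) := by
    rw [MvPolynomial.restrictDegree, MvPolynomial.restrictSupport_eq_span, Submodule.map_span_le]
    rintro _ ⟨n, hn, rfl⟩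
    have h1 : g (MvPolynomial.monomial n 1) = ∏ i, g (MvPolynomial.X i) ^ n i := by
      rw [MvPolynomial.monomial_eq, map_one, one_mul, Finsupp.prod_fintype _ _ (by simp), map_prod]
      simp
    have h2 : ∀ T : Finset (Fin d), ∏ i ∈ T, g (MvPolynomial.X i) ^ n i ∈ W ^ (c * T.card * m) := by
      intro T
      induction T using Finset.induction_on with
      | empty => simp [Submodule.one_le.1 le_rfl]
      | insert i T hi ih =>
        rw [Finset.prod_insert hi, Finset.card_insert_of_notMem hi,
          show c * (T.card + 1) * m = c * m + c * T.card * m by ring, pow_add]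
        refine Submodule.mul_mem_mul ?_ ih
        have h3 := Submodule.pow_mem_pow _ (he i) (n i)
        rw [← pow_mul] at h3
        exact span_insert_one_pow_mono s
          (Nat.mul_le_mul (Finset.le_sup (Finset.mem_univ i)) (hn i)) h3
    have h3 := h2 Finset.univ
    rw [Finset.card_univ, Fintype.card_fin, ← h1] at h3
    exact h3
  have : Module.Finite k (W ^ (c * d * m) : Submodule k A) :=
    Module.Finite.iff_fg.2 ((Submodule.fg_span (hfin.insert 1)).pow _)
  have h4 := Submodule.finrank_mono hle
  rwa [(Submodule.equivMapOfInjective g.toLinearMap hg _).symm.finrank_eq,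
    (finite_restrictDegree d m).2, finrank_span_insert_one_pow 𝒜 hfin hs hgen] at h4

/-- A graded algebra that is finite over a polynomial ring grows at most like this ring. -/
theorem exists_growth_upper_bound {s : Set A} (hfin : s.Finite) (hs : s ⊆ 𝒜 1)
    (hgen : Algebra.adjoin k s = ⊤) {d : ℕ} (g : MvPolynomial (Fin d) k →ₐ[k] A)
    (hg : g.Finite) :
    ∃ e C, ∀ n, ∑ i ∈ Finset.range (n + 1), Module.finrank k (𝒜 i) ≤ (e * n + 1) ^ d * C := by
  set W := Submodule.span k (insert 1 s) with hW
  let M : ℕ → Submodule k A := fun m => (MvPolynomial.restrictDegree (Fin d) k m).map g.toLinearMap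
  have hMmul : ∀ a b, M a * M b ≤ M (a + b) := by
    intro a b
    change Submodule.map g.toLinearMap _ * Submodule.map g.toLinearMap _ ≤ _
    rw [← Submodule.map_mul]
    exact Submodule.map_mono (restrictDegree_mul_le d a b)
  have hMmono : Monotone M := fun a b h => Submodule.map_mono (restrictDegree_mono d h)
  have hM1 : 1 ≤ M 0 := by
    rw [Submodule.one_le]
    exact ⟨1, by
      rw [SetLike.mem_coe, MvPolynomial.mem_restrictDegree]
      intro n hn i
      rw [MvPolynomial.support_one, Finset.mem_singleton] at hn
      simp [hn], map_one g⟩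
  have hMfin : ∀ m, Module.Finite k (M m) ∧ Module.finrank k (M m) ≤ (m + 1) ^ d := by
    intro m
    have := (finite_restrictDegree (k := k) d m).1
    refine ⟨inferInstanceAs (Module.Finite k (Submodule.map _ _)), ?_⟩
    rw [← (finite_restrictDegree (k := k) d m).2]
    exact Submodule.finrank_map_le _ _
  obtain ⟨G₀, hG₀⟩ : ∃ G : Finset A, ∀ a : A, ∃ m, a ∈ M m * Submodule.span k (G : Set A) := by
    algebraize [g.toRingHom]
    have : Module.Finite (MvPolynomial (Fin d) k) A := hg
    obtain ⟨G, hG⟩ := Module.Finite.fg_top (R := MvPolynomial (Fin d) k) (M := A)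
    refine ⟨G, fun a => ?_⟩
    have ha : a ∈ Submodule.span (MvPolynomial (Fin d) k) (G : Set A) := by rw [hG]; trivial
    induction ha using Submodule.closure_induction with
    | zero => exact ⟨0, zero_mem _⟩
    | add x y _ _ hx hy =>
      obtain ⟨m, hm⟩ := hx
      obtain ⟨n, hn⟩ := hy
      exact ⟨max m n, add_mem (mul_le_mul' (hMmono (le_max_left m n)) le_rfl hm)
        (mul_le_mul' (hMmono (le_max_right m n)) le_rfl hn)⟩
    | smul_mem b x hx =>
      obtain ⟨m, hm⟩ := exists_mem_restrictDegree b
      refine ⟨m, ?_⟩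
      rw [Algebra.smul_def]
      exact Submodule.mul_mem_mul ⟨b, hm, rfl⟩ (Submodule.subset_span hx)
  classical
  set G := insert 1 G₀
  set S := Submodule.span k (G : Set A) with hS
  have hG : ∀ a : A, ∃ m, a ∈ M m * S := fun a => (hG₀ a).imp fun m hm =>
    mul_le_mul' le_rfl (Submodule.span_mono (by simp [G])) hm
  choose m hm using hG
  set T : Finset A := insert 1 hfin.toFinset
  set e := (T ×ˢ G).sup fun x => m (x.1 * x.2) with he
  -- `S` spans module generators of `A`, with `1` added so that `W^n ≤ W^n S`. One factor of `W`
  -- costs at most `e` in the polynomial filtration, whence `W^n S ≤ M (en) S`.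
  have hWS : W * S ≤ M e * S := by
    rw [hW, hS, Submodule.span_mul_span, ← hS, Submodule.span_le]
    rintro _ ⟨v, hv, x, hx, rfl⟩
    have hmem : (v, x) ∈ T ×ˢ G := by
      rw [Finset.mem_product]
      refine ⟨?_, hx⟩
      simpa [T] using hv
    exact mul_le_mul'
      (hMmono (Finset.le_sup (f := fun x : A × A => m (x.1 * x.2)) hmem)) le_rfl (hm (v * x))
  have hpow : ∀ n, W ^ n * S ≤ M (e * n) * S := by
    intro n
    induction n with
    | zero => rw [pow_zero, mul_zero]; exact mul_le_mul' hM1 le_rfl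
    | succ n ih =>
      calc W ^ (n + 1) * S = W ^ n * (W * S) := by rw [pow_succ, mul_assoc]
        _ ≤ W ^ n * (M e * S) := mul_le_mul' le_rfl hWS
        _ = M e * (W ^ n * S) := by ring
        _ ≤ M e * (M (e * n) * S) := mul_le_mul' le_rfl ih
        _ = (M e * M (e * n)) * S := by rw [mul_assoc]
        _ ≤ M (e * (n + 1)) * S := mul_le_mul' ((hMmul _ _).trans_eq (by
            congr 1; ring)) le_rfl
  refine ⟨e, Module.finrank k S, fun n => ?_⟩
  have hSfin : Module.Finite k S := Module.Finite.iff_fg.2 (Submodule.fg_span G.finite_toSet)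
  have := (hMfin (e * n)).1
  have hle : W ^ n ≤ M (e * n) * S := by
    refine le_trans ?_ (hpow n)
    have h1 : (1 : Submodule k A) ≤ S :=
      Submodule.one_le.2 (Submodule.subset_span (by simp [G]))
    calc W ^ n = W ^ n * 1 := (mul_one _).symm
      _ ≤ W ^ n * S := mul_le_mul' le_rfl h1
  have hfin' : Module.Finite k (M (e * n) * S : Submodule k A) :=
    Module.Finite.iff_fg.2 ((Module.Finite.iff_fg.1 this).mul (Module.Finite.iff_fg.1 hSfin))
  rw [← finrank_span_insert_one_pow 𝒜 hfin hs hgen]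
  calc Module.finrank k (W ^ n : Submodule k A)
      ≤ Module.finrank k (M (e * n) * S : Submodule k A) := Submodule.finrank_mono hle
    _ ≤ Module.finrank k (M (e * n)) * Module.finrank k S := finrank_mul_le_finrank_mul _ _
    _ ≤ _ := Nat.mul_le_mul_right _ (hMfin (e * n)).2

end

end Growth

/-! ### Degree of the Hilbert polynomial. -/

section

open Filter Polynomial

theorem natDegree_eq_of_growth {H : ℕ → ℕ} {p : ℝ[X]} {N d c e C : ℕ} (hd : 2 ≤ d)
    (hp : ∀ n ≥ N, (H n : ℝ) = p.eval (n : ℝ))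
    (hlow : ∀ m, (m + 1) ^ d ≤ ∑ i ∈ Finset.range (c * m + 1), H i)
    (hup : ∀ n, ∑ i ∈ Finset.range (n + 1), H i ≤ (e * n + 1) ^ d * C) :
    p.natDegree = d - 1 := by
  have hbound : ∀ {P Q : ℝ[X]}, P.degree ≤ Q.degree → ∃ K : ℝ, 0 < K ∧ ∃ n₀, ∀ n : ℕ, n₀ ≤ n →
      |P.eval (n : ℝ)| ≤ K * |Q.eval (n : ℝ)| := by
    intro P Q h
    obtain ⟨K, hK, h1⟩ := (isBigO_atTop_of_degree_le (P := P) Q h).exists_pos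
    have h2 := tendsto_natCast_atTop_atTop.eventually h1.bound
    obtain ⟨n₀, h3⟩ := eventually_atTop.1 h2
    exact ⟨K, hK, n₀, fun n hn => by simpa using h3 n hn⟩
  rcases Nat.lt_trichotomy p.natDegree (d - 1) with hlt | heq | hgt
  · exfalso
    obtain ⟨t, rfl⟩ : ∃ t, d = t + 2 := ⟨d - 2, by omega⟩
    obtain ⟨K, hK, n₀, h⟩ := hbound (P := p) (Q := X ^ t) (by
      rw [degree_X_pow]
      exact degree_le_of_natDegree_le (by omega))
    -- `B` absorbs the finitely many values before the asymptotic bound holds. The partial sums are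
    -- then `O(m^(d-1))`, against the lower bound.
    set B : ℝ := ∑ i ∈ Finset.range (max n₀ N), (H i : ℝ) with hB
    have hB0 : 0 ≤ B := Finset.sum_nonneg fun _ _ => Nat.cast_nonneg _
    have hH : ∀ n : ℕ, (H n : ℝ) ≤ (B + K) * (n + 1 : ℝ) ^ t := by
      intro n
      have h1 : (1 : ℝ) ≤ (n + 1 : ℝ) ^ t := one_le_pow₀ (by linarith [n.cast_nonneg (α := ℝ)])
      by_cases hn : n < max n₀ N
      · have h2 : (H n : ℝ) ≤ B :=
          Finset.single_le_sum (f := fun i => (H i : ℝ)) (fun _ _ => Nat.cast_nonneg _)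
            (Finset.mem_range.2 hn)
        nlinarith
      · have h2 := h n (by omega)
        rw [← hp n (by omega), eval_pow, eval_X, abs_of_nonneg (by positivity),
          abs_of_nonneg (by positivity)] at h2
        have h3 : (n : ℝ) ^ t ≤ (n + 1 : ℝ) ^ t := pow_le_pow_left₀ (by positivity) (by linarith) t
        nlinarith
    have hL : ∀ m : ℕ, (m + 1 : ℝ) ^ (t + 2) ≤ (B + K) * (c + 1) ^ (t + 1) * (m + 1) ^ (t + 1) := by
      intro m
      have h1 : ((m + 1 : ℕ) : ℝ) ^ (t + 2) ≤ ∑ i ∈ Finset.range (c * m + 1), (H i : ℝ) := by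
        exact_mod_cast hlow m
      push_cast at h1
      have h2 : ∑ i ∈ Finset.range (c * m + 1), (H i : ℝ) ≤
          ∑ _i ∈ Finset.range (c * m + 1), (B + K) * ((c + 1) * (m + 1) : ℝ) ^ t := by
        refine Finset.sum_le_sum fun i hi => (hH i).trans ?_
        have hi' : (i : ℝ) ≤ c * m := by
          exact_mod_cast Nat.le_of_lt_succ (Finset.mem_range.1 hi)
        have : (i + 1 : ℝ) ≤ (c + 1) * (m + 1) := by
          nlinarith [c.cast_nonneg (α := ℝ), m.cast_nonneg (α := ℝ)]
        gcongr
      have h3 : ((c * m + 1 : ℕ) : ℝ) ≤ (c + 1) * (m + 1) := by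
        push_cast
        nlinarith [c.cast_nonneg (α := ℝ), m.cast_nonneg (α := ℝ)]
      rw [Finset.sum_const, Finset.card_range, nsmul_eq_mul] at h2
      calc _ ≤ _ := h1
        _ ≤ _ := h2
        _ ≤ ((c + 1) * (m + 1)) * ((B + K) * ((c + 1) * (m + 1) : ℝ) ^ t) := by gcongr
        _ = _ := by rw [mul_pow]; ring
    obtain ⟨m, hm⟩ := exists_nat_gt ((B + K) * (c + 1 : ℝ) ^ (t + 1))
    have h1 := hL m
    have h2 : (0 : ℝ) < (m + 1 : ℝ) ^ (t + 1) := by positivity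
    rw [pow_succ, mul_comm ((m + 1 : ℝ) ^ (t + 1))] at h1
    have := le_of_mul_le_mul_right h1 h2
    linarith
  · exact heq
  · exfalso
    have hp0 : p ≠ 0 := by rintro rfl; simp at hgt
    obtain ⟨K, hK, n₀, h⟩ := hbound (P := X ^ d) (Q := p) (by
      rw [degree_X_pow, degree_eq_natDegree hp0]
      exact_mod_cast (by omega : d ≤ p.natDegree))
    have hn : ∀ n : ℕ, n₀ ≤ n → N ≤ n → 0 < n → (n : ℝ) ≤ K * ((2 * e + 1) ^ d * C) := by
      intro n hn₀ hnN hn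
      -- In the window from `n+1` to `2n` every value is at least `n^d / K`, so the sum is at least
      -- `n^(d+1) / K`, too large for the upper bound.
      have h1 : ∀ i ∈ Finset.range n, (n : ℝ) ^ d ≤ K * H (n + 1 + i) := by
        intro i _
        have h2 := h (n + 1 + i) (by omega)
        rw [← hp _ (by omega), eval_pow, eval_X, abs_of_nonneg (by positivity),
          abs_of_nonneg (by positivity)] at h2
        refine le_trans ?_ h2
        push_cast
        gcongr
        linarith [i.cast_nonneg (α := ℝ)]
      have h2 := Finset.sum_le_sum h1
      rw [Finset.sum_const, Finset.card_range, nsmul_eq_mul, ← Finset.mul_sum] at h2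
      have h3 : ∑ i ∈ Finset.range n, (H (n + 1 + i) : ℝ) ≤
          ∑ i ∈ Finset.range (2 * n + 1), (H i : ℝ) := by
        rw [show 2 * n + 1 = (n + 1) + n by omega, Finset.sum_range_add]
        exact le_add_of_nonneg_left (Finset.sum_nonneg fun _ _ => Nat.cast_nonneg _)
      have h4 : ∑ i ∈ Finset.range (2 * n + 1), (H i : ℝ) ≤ (e * (2 * n) + 1) ^ d * C := by
        exact_mod_cast hup (2 * n)
      have h5 : (e * (2 * n) + 1 : ℝ) ^ d ≤ ((2 * e + 1) * n) ^ d := by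
        have : (1 : ℝ) ≤ n := by exact_mod_cast hn
        gcongr
        nlinarith
      have h6 : (n : ℝ) * n ^ d ≤ K * ((2 * e + 1) ^ d * C) * n ^ d :=
        calc (n : ℝ) * n ^ d ≤ K * ∑ i ∈ Finset.range n, (H (n + 1 + i) : ℝ) := h2
          _ ≤ K * (((2 * e + 1) * n) ^ d * C) := by
            gcongr
            exact h3.trans (h4.trans (by gcongr))
          _ = _ := by rw [mul_pow]; ring
      exact le_of_mul_le_mul_right h6 (by positivity)
    obtain ⟨m, hm⟩ := exists_nat_gt (K * ((2 * e + 1) ^ d * C : ℝ))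
    have h1 := hn (max (max n₀ N) (m + 1)) (by omega) (by omega) (by omega)
    have h2 : ((m + 1 : ℕ) : ℝ) ≤ (max (max n₀ N) (m + 1) : ℕ) := by
      exact_mod_cast le_max_right _ _
    push_cast at h1 h2
    linarith

end

/-- The Hilbert function of a standard graded algebra of Krull dimension `d ≥ 2` is eventually a
polynomial of degree `d - 1`. -/
theorem exists_hilbert_polynomial_natDegree {k A : Type*} [Field k] [CommRing A] [Algebra k A]
    (𝒜 : ℕ → Submodule k A) [GradedAlgebra 𝒜] (h : GradedHilbert.IsStandardGraded 𝒜) {d : ℕ}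
    (hd : 2 ≤ d) (hdim : ringKrullDim A = d) :
    ∃ (p : Polynomial ℝ) (N : ℕ), p.natDegree = d - 1 ∧
      ∀ n ≥ N, (Module.finrank k (𝒜 n) : ℝ) = p.eval (n : ℝ) := by
  obtain ⟨p, N, hp⟩ := exists_hilbert_polynomial 𝒜 h
  obtain ⟨s, hs, hgen⟩ := h.fg_degree_one
  have : Algebra.FiniteType k A := ⟨⟨s, hgen⟩⟩
  have : Nontrivial A := by
    by_contra hA
    rw [not_nontrivial_iff_subsingleton] at hA
    rw [ringKrullDim_eq_bot_of_subsingleton] at hdim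
    exact WithBot.bot_ne_coe hdim
  -- Noether normalization; the number of variables equals the Krull dimension because the extension
  -- is integral.
  obtain ⟨t, g, hginj, hgfin⟩ := exists_finite_inj_algHom_of_fg k A
  have ht : t = d := by
    algebraize [g.toRingHom]
    have : Module.Finite (MvPolynomial (Fin t) k) A := hgfin
    have : FaithfulSMul (MvPolynomial (Fin t) k) A :=
      (faithfulSMul_iff_algebraMap_injective _ _).2 hginj
    have h1 := ringKrullDim_eq_of_isIntegral (R := MvPolynomial (Fin t) k) (S := A)
    rw [hdim, MvPolynomial.ringKrullDim_of_isNoetherianRing, ringKrullDim_eq_zero_of_field,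
      zero_add, Nat.card_fin] at h1
    exact_mod_cast h1.symm
  subst ht
  obtain ⟨c, hlow⟩ := exists_growth_lower_bound 𝒜 s.finite_toSet hs hgen g hginj
  obtain ⟨e, C, hup⟩ := exists_growth_upper_bound 𝒜 s.finite_toSet hs hgen g hgfin
  exact ⟨p, N, natDegree_eq_of_growth hd hp hlow hup, hp⟩

/-! ### Veronese Hilbert series and conclusion. -/

theorem finrank_graded_zero {k A : Type*} [Field k] [CommRing A] [Algebra k A]
    (𝒜 : ℕ → Submodule k A) [GradedAlgebra 𝒜] (h : GradedHilbert.IsStandardGraded 𝒜) :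
    Module.finrank k (𝒜 0) = 1 := by
  rw [← (LinearEquiv.ofBijective (Algebra.linearMap k (𝒜 0)) h.degree_zero).finrank_eq,
    Module.finrank_self]

theorem hilbertSeries_veroneseGrading {k A : Type*} [Field k] [CommRing A] [Algebra k A]
    (𝒜 : ℕ → Submodule k A) [SetLike.GradedMonoid 𝒜] (r : ℕ) :
    GradedHilbert.hilbertSeries (GradedHilbert.veroneseGrading 𝒜 r) =
      PowerSeries.mk fun n => (Module.finrank k (𝒜 (n * r)) : ℤ) := by
  ext n
  simp only [GradedHilbert.hilbertSeries, PowerSeries.coeff_mk]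
  have hle : 𝒜 (n * r) ≤ Subalgebra.toSubmodule (GradedHilbert.veronese 𝒜 r) :=
    le_iSup (fun n => 𝒜 (n * r)) n
  rw [← (Submodule.comapSubtypeEquivOfLe hle).finrank_eq]
  rfl

theorem corollary1p5 (d : ℕ) (hd : 2 ≤ d) :
    ∃ α : ℕ → ℝ, (∀ i ∈ Finset.Icc 1 (d - 2), α i < 0) ∧
      ∀ (k : Type*) [Field k] (A : Type*) [CommRing A] [Algebra k A]
        (𝒜 : ℕ → Submodule k A) [GradedAlgebra 𝒜],
        GradedHilbert.IsStandardGraded 𝒜 → ringKrullDim A = d →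
        ∃ R : ℕ, 0 < R ∧ ∃ β : ℕ → ℕ → ℂ,
          (∀ r > R, (∀ i ∈ Finset.Icc 1 d, (β i r).im = 0) ∧
            ∀ i ∈ Finset.Icc 1 (d - 1), (β i r).re < 0) ∧
          (∀ i ∈ Finset.Icc 1 (d - 2),
            Filter.Tendsto (fun r => β i r) Filter.atTop (nhds (α i : ℂ))) ∧
          Filter.Tendsto (fun r => (β (d - 1) r).re) Filter.atTop Filter.atBot ∧
          Filter.Tendsto (fun r => β d r) Filter.atTop (nhds 0) ∧
          ∀ r > R, ∃ h : Polynomial ℤ,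
            GradedHilbert.IsHPolynomial (GradedHilbert.veroneseGrading 𝒜 r) d h ∧
            h.map (Int.castRingHom ℂ) =
              ∏ i ∈ Finset.Icc 1 d, (1 - Polynomial.C (β i r) * Polynomial.X) := by
  obtain ⟨α, hα, H⟩ := exists_veronese_root_limits d hd
  refine ⟨α, hα, ?_⟩
  intro k _ A _ _ 𝒜 _ hA hdim
  obtain ⟨p, N, hp, hpN⟩ := exists_hilbert_polynomial_natDegree 𝒜 hA hd hdim
  obtain ⟨R, hR, β, hneg, hlim, hbot, hzero, hfac⟩ :=
    H (fun n => Module.finrank k (𝒜 n)) p N hp hpN (finrank_graded_zero 𝒜 hA)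
  refine ⟨R, hR, fun i r => (β i r : ℂ), fun r hr => ⟨fun i _ => Complex.ofReal_im _, hneg r hr⟩,
    fun i hi => ?_, hbot, ?_, fun r hr => ?_⟩
  · exact (Complex.continuous_ofReal.tendsto _).comp (hlim i hi)
  · simpa [Function.comp_def] using (Complex.continuous_ofReal.tendsto _).comp hzero
  · obtain ⟨h, hh, hmap⟩ := hfac r hr
    refine ⟨h, ?_, ?_⟩
    · rw [GradedHilbert.IsHPolynomial, hilbertSeries_veroneseGrading]
      exact hh
    · have h1 : Int.castRingHom ℂ = Complex.ofRealHom.comp (Int.castRingHom ℝ) :=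
        RingHom.ext_int _ _
      rw [h1, ← Polynomial.map_map, hmap, Polynomial.map_prod]
      simp
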